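/- Let $X$ be a closed subset of $\mathbb{R}^d$, let $\rho$ be a Borel probability measure on $X\times\mathbb{R}$ with marginal $\rho_X$ on $X$ and $\int y^2\,d\rho<\infty$ (outputs in a set $Y\subseteq\mathbb{R}$ are included by regarding $\rho$ as a measure on $X\times\mathbb R$). Let $f_\rho(x)=\int y\,d\rho(y|x)$ be the regression function, $\mathcal{E}(f)=\int (f(x)-y)^2\,d\rho(x,y)$, and $\|f\|_\rho=\big(\int f^2\,d\rho_X\big)^{1/2}$. Let $(V,\mu)$ be a probability space, let $\phi:V\times X\to\mathbb{R}$, $(v,x)\mapsto\phi_v(x)$, be measurable and square integrable for $\mu\otimes\rho_X$, with $\phi_\cdot(x)\in L^2(\mu)$ for every $x \in X$, and let $K(x,x')=\int_V\phi_v(x)\phi_v(x')\,d\mu(v)$ for all $x,x'\in X$. Let $L_K f=\int_X f(x)K(x,\cdot)\,d\rho_X(x)$ be the integral operator of $K$ on $L^2(\rho_X)$. Assume: 1. (Boundedness) $K$ is measurable and there is $\kappa\ge 1$ with $K(x,x)\le\kappa^2$ for $\rho_X$-almost every $x$, and $\phi_v(x)\phi_v(x')\le\kappa^2$ for $\mu\otimes\rho_X\otimes\rho_X$-almost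 every $(v,x,x')$. 2. (Regularity) There are $\zeta>0$ and $R>0$ with $\|L_K^{-\zeta}f_\rho\|_\rho\le R$, that is, $f_\rho=L_K^{\zeta}g$ in $L^2(\rho_X)$ for some $g \in L^2(\rho_X)$ with $\|g\|_\rho\le R$. 3. (Capacity) There are $\gamma\in[0,1]$ and $c_\gamma>0$ with $\operatorname{tr}\big(L_K(L_K+\lambda I)^{-1}\big)\le c_\gamma\lambda^{-\gamma}$ for all $\lambda>0$. Suppose $\gamma\ne 1$ and $\frac{\gamma}{\gamma+1}<\theta<1$. Let $T\ge1$ be an integer, let the pairs $(z_t,v_t)$, $z_t=(x_t,y_t)$, $1\le t\le T$, be independent with common law $\rho\otimes\mu$, and let $f_1=0$, $$f_{t+1}=f_t-\eta_t\,(f_t(x_t)-y_t)\,\phi_{v_t}(x_t)\,\phi_{v_t},\qquad \eta_t=\eta_1t^{-\theta},\qquad 1\le t\le T,$$ where $$0<\eta_1\le\frac{1}{4\kappa^2\,(2^{2\theta}c_\gamma+\kappa^2)\,c_{\theta,\gamma}},\qquad c_{\theta,\gamma}=\max_{1\le t\le T}\Big\{t^{\gamma-\theta(\gamma+1)+(2\theta-1)_+}\ln(2t)\Big\},\qquad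 (a)_+=\max(a,0).$$ Then for every integer $t$ with $1\le t\le T$, $$\mathbb{E}\,\|f_{t+1}-f_\rho\|_\rho^2\le C\Big(t^{2\zeta(\theta-1)}+t^{\gamma-\theta(\gamma+1)+(2\theta-1)_+}\ln t\Big),$$ where the constant $C>0$ depends only on $\zeta,R,\kappa,\gamma,c_\gamma,\theta,\eta_1,\|f_\rho\|_\rho$ and $\mathcal{E}(f_\rho)$; in particular it does not depend on $t$ or $T$. -/

import Mathlib

open MeasureTheory ProbabilityTheory
open scoped ENNReal

noncomputable section

namespace DoublyStochastic

/-! ### Powers and traces of operators on a real Hilbert space -/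

section Operators

variable {H : Type*} [NormedAddCommGroup H] [InnerProductSpace ℝ H] [CompleteSpace H]

/-- The power `L ^ ζ` (for `ζ > 0`) of a compact positive operator `L`, through its spectral
decomposition: `L ^ ζ g = ∑ s ^ ζ • P_s g`, where `P_s` is the orthogonal projection onto the
eigenspace `ker (L - s)`. Only the eigenvalues `s > 0` of `L` contribute. -/
def opPow (L : H →L[ℝ] H) (ζ : ℝ) (g : H) : H :=
  ∑' s : ℝ, s ^ ζ • (L - s • ContinuousLinearMap.id ℝ H).ker.starProjection g

/-- The trace `∑ ⟨T e_i, e_i⟩`, in `[0, ∞]`, of a positive operator `T`, taken over an orthonormal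
(Hilbert) basis; its value does not depend on the basis. -/
def opTrace (T : H →L[ℝ] H) : ℝ≥0∞ :=
  ∑' i, ENNReal.ofReal
    (inner ℝ (T ((exists_hilbertBasis ℝ H).choose_spec.choose i))
      ((exists_hilbertBasis ℝ H).choose_spec.choose i))

/-- The effective dimension `tr (L (L + lam I)⁻¹)`. (For positive `L` and `lam > 0` the operator
`L + lam I` is invertible, and `Ring.inverse` is its inverse.) -/
def effectiveDim (L : H →L[ℝ] H) (lam : ℝ) : ℝ≥0∞ :=
  opTrace (L * Ring.inverse (L + lam • (1 : H →L[ℝ] H)))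

end Operators

/-! ### The integral operator of a kernel -/

section KernelOperator

variable {X : Type*} [MeasurableSpace X] {ν : Measure X} [IsFiniteMeasure ν]

theorem ae_memLp_slice {K : X → X → ℝ} (hK : MemLp (Function.uncurry K) 2 (ν.prod ν)) :
    ∀ᵐ x' ∂ν, MemLp (fun x => K x x') 2 ν := by
  have h1 : ∀ᵐ x' ∂ν, AEStronglyMeasurable (fun x => K x x') ν := hK.1.prodMk_right
  have h2 := ((memLp_two_iff_integrable_sq hK.1).1 hK).swap.prod_right_ae
  filter_upwards [h1, h2] with x' h1 h2
  exact (memLp_two_iff_integrable_sq h1).2 h2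

theorem eLpNorm_kernel_le {K : X → X → ℝ} (hK : MemLp (Function.uncurry K) 2 (ν.prod ν))
    {f : X → ℝ} (hf : MemLp f 2 ν) :
    eLpNorm (fun x' => ∫ x, f x * K x x' ∂ν) 2 ν
      ≤ eLpNorm (Function.uncurry K) 2 (ν.prod ν) * eLpNorm f 2 ν := by
  have two : (2 : ℝ≥0∞) ≠ 0 := by norm_num
  have twot : (2 : ℝ≥0∞) ≠ ⊤ := by norm_num
  have hm : AEMeasurable (fun p : X × X => ‖Function.uncurry K p‖ₑ ^ (2 : ℝ)) (ν.prod ν) :=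
    hK.1.enorm.pow_const _
  simp only [eLpNorm_eq_lintegral_rpow_enorm_toReal two twot, ENNReal.toReal_ofNat]
  rw [← ENNReal.mul_rpow_of_nonneg _ _ (by norm_num)]
  refine ENNReal.rpow_le_rpow ?_ (by norm_num)
  rw [lintegral_prod_symm _ hm, ← lintegral_mul_const'' _ hm.lintegral_prod_left']
  refine lintegral_mono_ae ?_
  filter_upwards [ae_memLp_slice hK] with x' hx'
  have h1 : ‖∫ x, f x * K x x' ∂ν‖ₑ ≤ ∫⁻ x, ‖K x x'‖ₑ * ‖f x‖ₑ ∂ν := by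
    refine (enorm_integral_le_lintegral_enorm _).trans (le_of_eq ?_)
    simp [enorm_mul, mul_comm]
  have h2 := ENNReal.lintegral_mul_le_Lp_mul_Lq ν Real.HolderConjugate.two_two
    hx'.1.enorm hf.1.enorm
  have h3 := ENNReal.rpow_le_rpow (h1.trans h2) (z := 2) (by norm_num)
  rw [ENNReal.mul_rpow_of_nonneg _ _ (by norm_num), ← ENNReal.rpow_mul, ← ENNReal.rpow_mul] at h3
  norm_num at h3 ⊢
  exact h3

theorem memLp_kernel {K : X → X → ℝ} (hK : MemLp (Function.uncurry K) 2 (ν.prod ν))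
    {f : X → ℝ} (hf : MemLp f 2 ν) :
    MemLp (fun x' => ∫ x, f x * K x x' ∂ν) 2 ν := by
  refine ⟨?_, (eLpNorm_kernel_le hK hf).trans_lt (ENNReal.mul_lt_top hK.2 hf.2)⟩
  have h : AEStronglyMeasurable (fun p : X × X => f p.2 * K p.2 p.1) (ν.prod ν) :=
    (hf.1.comp_snd).mul hK.1.prod_swap
  exact h.integral_prod_right'

/-- The integral operator on `L²(ν)` of a kernel `K ∈ L²(ν ⊗ ν)`. -/
def integralOpOfMemLp (K : X → X → ℝ) (hK : MemLp (Function.uncurry K) 2 (ν.prod ν)) :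
    Lp ℝ 2 ν →L[ℝ] Lp ℝ 2 ν :=
  LinearMap.mkContinuous
    { toFun := fun f => (memLp_kernel hK (Lp.memLp f)).toLp _
      map_add' := by
        intro f g
        rw [← MemLp.toLp_add, MemLp.toLp_eq_toLp_iff]
        filter_upwards [ae_memLp_slice hK] with x' hx'
        have hf : Integrable (fun x => f x * K x x') ν := (Lp.memLp f).integrable_mul hx'
        have hg : Integrable (fun x => g x * K x x') ν := (Lp.memLp g).integrable_mul hx'
        rw [Pi.add_apply, ← integral_add hf hg]
        refine integral_congr_ae ?_
        filter_upwards [Lp.coeFn_add f g] with x hx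
        rw [hx, Pi.add_apply, add_mul]
      map_smul' := by
        intro c f
        rw [RingHom.id_apply, ← MemLp.toLp_const_smul, MemLp.toLp_eq_toLp_iff]
        refine Filter.Eventually.of_forall fun x' => ?_
        rw [Pi.smul_apply, ← integral_smul]
        refine integral_congr_ae ?_
        filter_upwards [Lp.coeFn_smul c f] with x hx
        rw [hx, Pi.smul_apply, smul_mul_assoc] }
    (eLpNorm (Function.uncurry K) 2 (ν.prod ν)).toReal
    (by
      intro f
      change ‖(memLp_kernel hK (Lp.memLp f)).toLp _‖ ≤ _
      rw [Lp.norm_toLp, Lp.norm_def, ← ENNReal.toReal_mul]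
      exact ENNReal.toReal_mono (ENNReal.mul_ne_top hK.2.ne (Lp.memLp f).2.ne)
        (eLpNorm_kernel_le hK (Lp.memLp f)))

open Classical in
/-- The integral operator `L_K f = ∫ f(x) K(x, ·) dν(x)` on `L²(ν)`. It is defined as soon as
`K ∈ L²(ν ⊗ ν)`, in particular for every measurable positive semidefinite kernel with
`K(x, x) ≤ κ²`. -/
def integralOp (K : X → X → ℝ) (ν : Measure X) [IsFiniteMeasure ν] :
    Lp ℝ 2 ν →L[ℝ] Lp ℝ 2 ν :=
  if hK : MemLp (Function.uncurry K) 2 (ν.prod ν) then integralOpOfMemLp K hK else 0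

theorem integralOp_apply {K : X → X → ℝ} (hK : MemLp (Function.uncurry K) 2 (ν.prod ν))
    (f : Lp ℝ 2 ν) :
    integralOp K ν f =ᵐ[ν] fun x' => ∫ x, f x * K x x' ∂ν := by
  rw [integralOp, dif_pos hK]
  exact MemLp.coeFn_toLp (memLp_kernel hK (Lp.memLp f))

end KernelOperator

/-! ### The learning problem -/

section Learning

variable {X : Type*} [MeasurableSpace X] {V : Type*} [MeasurableSpace V]

/-- The expected risk `ℰ(f) = ∫ (f(x) - y)² dρ(x, y)`. -/
def risk (ρ : Measure (X × ℝ)) (f : X → ℝ) : ℝ :=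
  ∫ z, (f z.1 - z.2) ^ 2 ∂ρ

/-- The regression function `f_ρ(x) = ∫ y dρ(y | x)`. -/
def regressionFun (ρ : Measure (X × ℝ)) [IsFiniteMeasure ρ] (x : X) : ℝ :=
  ∫ y, y ∂(ρ.condKernel x)

/-- The norm `‖f‖_ρ` of `L²(ρ_X)`, where `ρ_X = ρ.fst` is the marginal of `ρ` on `X`. -/
def rhoNorm (ρ : Measure (X × ℝ)) (f : X → ℝ) : ℝ :=
  Real.sqrt (∫ x, f x ^ 2 ∂ρ.fst)

/-- `𝔼 ‖F - f_ρ‖_ρ²` for a random function `F`, as an element of `[0, ∞]`. -/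
def expectedSqError {Ω : Type*} [MeasurableSpace Ω] (P : Measure Ω) (ρ : Measure (X × ℝ))
    [IsFiniteMeasure ρ] (F : Ω → X → ℝ) : ℝ≥0∞ :=
  ∫⁻ ω, ∫⁻ x, ENNReal.ofReal ((F ω x - regressionFun ρ x) ^ 2) ∂ρ.fst ∂P

/-- The random features `φ`: jointly measurable, square integrable for `μ ⊗ ρ_X`, and
`K(x, x') = ⟨φ(·, x), φ(·, x')⟩` in `L²(μ)`. In particular `K` is symmetric and positive
semidefinite. -/
structure IsFeatureRepresentation (μ : Measure V) (ρX : Measure X) (φ : V → X → ℝ)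
    (K : X → X → ℝ) : Prop where
  measurable : Measurable (Function.uncurry φ)
  memLp : MemLp (Function.uncurry φ) 2 (μ.prod ρX)
  memLp_section : ∀ x, MemLp (fun v => φ v x) 2 μ
  kernel_eq : ∀ x x', K x x' = ∫ v, φ v x * φ v x' ∂μ

/-- Boundedness of the kernel and of the random features. -/
structure BoundedFeatures (μ : Measure V) (ρX : Measure X) (φ : V → X → ℝ) (K : X → X → ℝ)
    (κ : ℝ) : Prop where
  measurable_kernel : Measurable (Function.uncurry K)
  kernel_le : ∀ᵐ x ∂ρX, K x x ≤ κ ^ 2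
  feature_le : ∀ᵐ p ∂(μ.prod (ρX.prod ρX)), φ p.1 p.2.1 * φ p.1 p.2.2 ≤ κ ^ 2

/-- Regularity `‖L_K^{-ζ} f‖ ≤ R`, that is, `f = L_K^ζ g` almost everywhere for some
`g ∈ L²(ρ_X)` with `‖g‖ ≤ R`. -/
def SourceCondition (K : X → X → ℝ) (ρX : Measure X) [IsFiniteMeasure ρX] (f : X → ℝ)
    (ζ R : ℝ) : Prop :=
  ∃ g : Lp ℝ 2 ρX, ‖g‖ ≤ R ∧ ((opPow (integralOp K ρX) ζ g : Lp ℝ 2 ρX) : X → ℝ) =ᵐ[ρX] f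

/-- Capacity: `tr (L_K (L_K + lam I)⁻¹) ≤ cγ lam^{-γ}` for all `lam > 0`. -/
def CapacityCondition (K : X → X → ℝ) (ρX : Measure X) [IsFiniteMeasure ρX] (γ cγ : ℝ) : Prop :=
  ∀ lam : ℝ, 0 < lam →
    effectiveDim (integralOp K ρX) lam ≤ ENNReal.ofReal (cγ * lam ^ (-γ))

/-- The doubly stochastic learning algorithm with step sizes `η_t` and regularization parameter
`lam`: `f_1 = 0` and
`f_{t+1} = (1 - η_t lam) f_t - η_t (f_t(x_t) - y_t) φ(v_t, x_t) φ(v_t, ·)` for `t ≥ 1`, on the data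
`z_t = (x_t, y_t)` and `v_t`, `t ≥ 1`. (The value at `0` is not used.) -/
def dslIterate (φ : V → X → ℝ) (η : ℕ → ℝ) (lam : ℝ) (z : ℕ → X × ℝ) (v : ℕ → V) : ℕ → X → ℝ
  | 0 => fun _ => 0
  | 1 => fun _ => 0
  | t + 2 => fun x =>
      (1 - η (t + 1) * lam) * dslIterate φ η lam z v (t + 1) x
        - η (t + 1) * (dslIterate φ η lam z v (t + 1) (z (t + 1)).1 - (z (t + 1)).2)
          * φ (v (t + 1)) (z (t + 1)).1 * φ (v (t + 1)) x

/-- The pairs `(z_t, v_t)`, `1 ≤ t ≤ T`, are independent, each with law `ρ ⊗ μ`. -/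
structure IsSample {Ω : Type*} [MeasurableSpace Ω] (P : Measure Ω) (ρ : Measure (X × ℝ))
    (μ : Measure V) (T : ℕ) (z : ℕ → Ω → X × ℝ) (v : ℕ → Ω → V) : Prop where
  hasLaw : ∀ t ∈ Set.Icc 1 T, HasLaw (fun ω => (z t ω, v t ω)) (ρ.prod μ) P
  indep : iIndepFun (fun (t : Set.Icc 1 T) ω => (z t ω, v t ω)) P

end Learning

/-- The exponent `γ - θ(γ + 1) + (2θ - 1)₊`. -/
def rateExp (θ γ : ℝ) : ℝ :=
  γ - θ * (γ + 1) + max (2 * θ - 1) 0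

/-- `c_{θ,γ} = max_{t ∈ [T]} t^{γ - θ(γ + 1) + (2θ - 1)₊} ln(2t)`, for `T ≥ 1`. -/
def cThetaGamma (θ γ : ℝ) (T : ℕ) : ℝ :=
  ⨆ t : Set.Icc 1 T, ((t : ℕ) : ℝ) ^ rateExp θ γ * Real.log (2 * ((t : ℕ) : ℝ))

end DoublyStochastic

end

open DoublyStochastic

/-! Write `e_n` for the error `f_{n+1} - f_ρ` in `L²(ρ_X)` and `L` for the integral operator, and
let `A(k,n)` be the product of the factors `1 - η_j L` over `k < j ≤ n`. Given the past, one step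
has mean `(1 - η L) e`, because `E[y|x] = f_ρ(x)` and `L` is the second moment operator of the
features. The fluctuation is controlled by the residual, hence by the current error plus the
irreducible risk. Carrying the seminorm `‖q(L) ·‖` for an arbitrary polynomial `q` closes the
recursion, and unrolling it (`expErr_le`) gives `E‖e_n‖² ≤ ‖A(0,n) f_ρ‖² + Σ_{s ≤ n} η_s² κ² (∫
‖A(s,n) φ_v‖² dμ) (2 E‖e_{s-1}‖² + 2 ℰ(f_ρ))`.

The bias is a scalar estimate on the spectrum: `s^ζ ∏(1 - η_j s) ≤ s^ζ exp(-σ s)`, which is of order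
`σ^{-ζ}` with `σ` the sum of the step sizes (`IsFeatureMap.bias_le`).

In the noise, the integral is the trace of `L A²`. From `(1 + σL) A ≤ 1` follows `L A² ≤ σ⁻¹ L (L +
σ⁻¹)⁻¹`, so the capacity condition at `lam = σ⁻¹` bounds it by `cγ σ^{γ-1}`
(`integral_norm_sq_stepPoly_le`). These operator inequalities need only polynomials in `L`, and rest
on the fact that products of positive polynomials in `L` are positive (`PolyPos.mul`).

The weights of the noise sum total at most a constant times `n^{rateExp} (1 + log n)`, which tends
to zero (`sum_noiseWeight_le`, `rateExp_neg`). A Gronwall argument (`exists_bound_of_recursion`)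
then bounds `E‖e_n‖²` uniformly, and substituting this bound back into the recursion gives the rate.
The step size restriction enters through `η₁ κ² ≤ 1`.

The features are bounded only almost everywhere, so the argument runs with their truncation `clip`,
which almost surely yields the same iterates up to null sets. -/

namespace DoublyStochastic

open Polynomial

/-! ### Positivity of polynomials in a symmetric operator -/

section PolynomialCalculus

variable {H : Type*} [NormedAddCommGroup H] [InnerProductSpace ℝ H]

/-- The polynomial `q` evaluated at the operator `L`. -/
noncomputable def polyOp (L : H →L[ℝ] H) (q : ℝ[X]) : H →L[ℝ] H := aeval L q

/-- The quadratic form of `q(L)` is nonnegative. -/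
def PolyPos (L : H →L[ℝ] H) (q : ℝ[X]) : Prop := ∀ x, 0 ≤ inner ℝ (polyOp L q x) x

variable {L : H →L[ℝ] H}

@[simp] theorem polyOp_one : polyOp L 1 = 1 := by simp [polyOp]

@[simp] theorem polyOp_one_apply (x : H) : polyOp L 1 x = x := by simp

@[simp] theorem polyOp_X (x : H) : polyOp L X x = L x := by simp [polyOp]

@[simp] theorem polyOp_C (c : ℝ) (x : H) : polyOp L (C c) x = c • x := by
  simp [polyOp, Algebra.algebraMap_eq_smul_one]

@[simp] theorem polyOp_add (p q : ℝ[X]) (x : H) :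
    polyOp L (p + q) x = polyOp L p x + polyOp L q x := by simp [polyOp]

@[simp] theorem polyOp_sub (p q : ℝ[X]) (x : H) :
    polyOp L (p - q) x = polyOp L p x - polyOp L q x := by simp [polyOp]

@[simp] theorem polyOp_mul (p q : ℝ[X]) (x : H) :
    polyOp L (p * q) x = polyOp L p (polyOp L q x) := by simp [polyOp]

theorem polyOp_eigenvector {s : ℝ} {x : H} (hx : L x = s • x) (q : ℝ[X]) :
    polyOp L q x = q.eval s • x := by
  induction q using Polynomial.induction_on' with
  | add p q hp hq => simp [hp, hq, add_smul]
  | monomial n a =>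
    rw [← C_mul_X_pow_eq_monomial]
    induction n with
    | zero => simp
    | succ n ih =>
      rw [pow_succ, ← mul_assoc, polyOp_mul, polyOp_X, hx, map_smul, ih, smul_smul]
      congr 1
      simp only [eval_mul, eval_X]
      ring

theorem polyOp_symm (hL : ∀ x y, inner ℝ (L x) y = inner ℝ x (L y)) (q : ℝ[X]) (x y : H) :
    inner ℝ (polyOp L q x) y = inner ℝ x (polyOp L q y) := by
  induction q using Polynomial.induction_on' generalizing x y with
  | add p q hp hq => simp [hp, hq, inner_add_left, inner_add_right]
  | monomial n a =>
    rw [← C_mul_X_pow_eq_monomial]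
    induction n generalizing x y with
    | zero => simp [inner_smul_left, inner_smul_right]
    | succ n ih =>
      rw [pow_succ, ← mul_assoc, polyOp_mul, polyOp_X, ih, hL, ← polyOp_X (L := L),
        ← polyOp_mul, mul_comm X]

namespace PolyPos

theorem add {p q : ℝ[X]} (hp : PolyPos L p) (hq : PolyPos L q) : PolyPos L (p + q) := fun x => by
  simpa [inner_add_left] using add_nonneg (hp x) (hq x)

theorem const {c : ℝ} (hc : 0 ≤ c) : PolyPos L (C c) := fun x => by
  simpa [inner_smul_left] using mul_nonneg hc real_inner_self_nonneg

theorem one : PolyPos L 1 := by simpa using const (L := L) zero_le_one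

theorem const_mul {c : ℝ} (hc : 0 ≤ c) {q : ℝ[X]} (hq : PolyPos L q) :
    PolyPos L (C c * q) := fun x => by
  simpa [inner_smul_left] using mul_nonneg hc (hq x)

theorem sq_mul (hL : ∀ x y, inner ℝ (L x) y = inner ℝ x (L y)) {q : ℝ[X]} (hq : PolyPos L q)
    (p : ℝ[X]) : PolyPos L (p ^ 2 * q) := fun x => by
  rw [sq, mul_assoc, mul_comm p q, polyOp_mul, polyOp_symm hL]
  simpa using hq (polyOp L p x)

/-- The iteration `p ↦ p - p²`, whose squares sum to `p`. -/
noncomputable def sqIter (p : ℝ[X]) : ℕ → ℝ[X]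
  | 0 => p
  | n + 1 => sqIter p n - sqIter p n ^ 2

/-- The interval `[0, 1]` is preserved because `a - a² = a²(1 - a) + (1 - a)²a` and `1 - (a - a²) =
(1 - a) + a²`; each summand is positive by `sq_mul` or by hypothesis. -/
theorem sqIter_pos (hL : ∀ x y, inner ℝ (L x) y = inner ℝ x (L y)) {p : ℝ[X]}
    (h0 : PolyPos L p) (h1 : PolyPos L (1 - p)) (n : ℕ) :
    PolyPos L (sqIter p n) ∧ PolyPos L (1 - sqIter p n) := by
  induction n with
  | zero => exact ⟨h0, h1⟩
  | succ n ih =>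
    obtain ⟨ha, hb⟩ := ih
    constructor
    · have := (sq_mul hL hb (sqIter p n)).add (sq_mul hL ha (1 - sqIter p n))
      convert this using 1
      rw [sqIter]; ring
    · have := hb.add (sq_mul hL one (sqIter p n))
      convert this using 1
      rw [sqIter]; ring

theorem sum_norm_sqIter_le (hL : ∀ x y, inner ℝ (L x) y = inner ℝ x (L y)) {p : ℝ[X]}
    (h0 : PolyPos L p) (h1 : PolyPos L (1 - p)) (x : H) (n : ℕ) :
    ∑ k ∈ Finset.range n, ‖polyOp L (sqIter p k) x‖ ^ 2 ≤ inner ℝ (polyOp L p x) x := by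
  have key : ∀ n, ∑ k ∈ Finset.range n, ‖polyOp L (sqIter p k) x‖ ^ 2
      + inner ℝ (polyOp L (sqIter p n) x) x = inner ℝ (polyOp L p x) x := by
    intro n
    induction n with
    | zero => simp [sqIter]
    | succ n ih =>
      rw [Finset.sum_range_succ, ← ih, sqIter, polyOp_sub, inner_sub_left, sq (sqIter p n),
        polyOp_mul, polyOp_symm hL _ (polyOp L (sqIter p n) x), real_inner_self_eq_norm_sq]
      ring
  have := (sqIter_pos hL h0 h1 n).1 x
  linarith [key n]

/-- F. Riesz's argument. Along the iteration `a ↦ a - a²` the form of `a q` decreases, since `a² q`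
is positive. The telescoped squares are summable, so `a_n(L) x → 0` and the form of `a_n q` tends to
zero; its initial value is therefore nonnegative. -/
theorem mul_of_le_one (hL : ∀ x y, inner ℝ (L x) y = inner ℝ x (L y)) {p q : ℝ[X]}
    (h0 : PolyPos L p) (h1 : PolyPos L (1 - p)) (hq : PolyPos L q) : PolyPos L (p * q) := by
  intro x
  have key : ∀ n, inner ℝ (polyOp L (sqIter p n * q) x) x ≤ inner ℝ (polyOp L (p * q) x) x := by
    intro n
    induction n with
    | zero => exact le_rfl
    | succ n ih =>
      refine le_trans ?_ ih
      have := sq_mul hL hq (sqIter p n) x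
      rw [sqIter, sub_mul, polyOp_sub, inner_sub_left]
      linarith
  have hs : Summable fun k => ‖polyOp L (sqIter p k) x‖ ^ 2 :=
    summable_of_sum_range_le (fun _ => by positivity) (sum_norm_sqIter_le hL h0 h1 x)
  have ht : Filter.Tendsto (fun k => polyOp L (sqIter p k) x) Filter.atTop (nhds 0) := by
    rw [tendsto_zero_iff_norm_tendsto_zero]
    have := hs.tendsto_atTop_zero.sqrt
    simpa [Real.sqrt_sq] using this
  have ht2 : Filter.Tendsto (fun k => inner ℝ (polyOp L (sqIter p k * q) x) x) Filter.atTop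
      (nhds 0) := by
    have : Filter.Tendsto (fun k => inner ℝ (polyOp L q (polyOp L (sqIter p k) x)) x)
        Filter.atTop (nhds (inner ℝ (polyOp L q 0) x)) :=
      (((polyOp L q).continuous.tendsto 0).comp ht).inner tendsto_const_nhds
    simpa [mul_comm] using this
  exact le_of_tendsto' ht2 key

theorem mul (hL : ∀ x y, inner ℝ (L x) y = inner ℝ x (L y)) {p q : ℝ[X]}
    (hp : PolyPos L p) (hq : PolyPos L q) : PolyPos L (p * q) := by
  set c : ℝ := (‖polyOp L p‖ + 1)⁻¹
  have hc : 0 < c := by positivity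
  have h1 : PolyPos L (1 - C c * p) := fun x => by
    simp only [polyOp_sub, polyOp_one_apply, polyOp_mul, polyOp_C, inner_sub_left,
      inner_smul_left, real_inner_self_eq_norm_sq]
    have h2 : inner ℝ (polyOp L p x) x ≤ ‖polyOp L p‖ * ‖x‖ ^ 2 := by
      refine (real_inner_le_norm _ _).trans ?_
      rw [sq, ← mul_assoc]
      exact mul_le_mul_of_nonneg_right ((polyOp L p).le_opNorm x) (norm_nonneg _)
    have h3 : c * (‖polyOp L p‖ + 1) = 1 := inv_mul_cancel₀ (by positivity)
    have h4 := mul_le_mul_of_nonneg_left h2 hc.le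
    simp only [conj_trivial]
    nlinarith [sq_nonneg ‖x‖]
  have h2 := mul_of_le_one hL (hp.const_mul hc.le) h1 hq
  have h3 := h2.const_mul (inv_nonneg.2 hc.le)
  have h4 : C c⁻¹ * (C c * p * q) = p * q := by
    rw [← mul_assoc, ← mul_assoc, ← C_mul, inv_mul_cancel₀ hc.ne']; simp
  rwa [h4] at h3

end PolyPos

/-- The polynomial `∏_{k < j ≤ n} (1 - η_j X)`. -/
noncomputable def stepPoly (η : ℕ → ℝ) (k n : ℕ) : ℝ[X] :=
  ∏ j ∈ Finset.Ioc k n, (1 - C (η j) * X)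

/-- Operator form of `∏(1 - η_j s) ≤ 1 / (1 + σ s)`. The induction step is the identity `(1 + (σ +
η)X)(1 - ηX) = 1 + σX - η(σ + η)X²`, whose last term has a sign. -/
theorem PolyPos.one_sub_stepPoly (hL : ∀ x y, inner ℝ (L x) y = inner ℝ x (L y))
    {η : ℕ → ℝ} (hη : ∀ j, 0 ≤ η j)
    (h1 : ∀ j, 1 ≤ j → PolyPos L (1 - C (η j) * X)) (k n : ℕ) :
    PolyPos L (stepPoly η k n) ∧
      PolyPos L (1 - (1 + C (∑ j ∈ Finset.Ioc k n, η j) * X) * stepPoly η k n) := by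
  induction n with
  | zero => simpa [stepPoly, PolyPos.one] using PolyPos.const (L := L) le_rfl
  | succ n ih =>
    rcases le_or_gt k n with hkn | hkn
    · obtain ⟨iha, ihb⟩ := ih
      have hs : stepPoly η k (n + 1) = stepPoly η k n * (1 - C (η (n + 1)) * X) :=
        Finset.prod_Ioc_succ_top hkn _
      rw [hs]
      refine ⟨iha.mul hL (h1 _ (by omega)), ?_⟩
      rw [Finset.sum_Ioc_succ_top hkn]
      have h2 : PolyPos L (C (η (n + 1) * (∑ j ∈ Finset.Ioc k n, η j + η (n + 1)))
          * (X ^ 2 * stepPoly η k n)) :=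
        (iha.sq_mul hL X).const_mul
          (mul_nonneg (hη _) (add_nonneg (Finset.sum_nonneg fun _ _ => hη _) (hη _)))
      convert ihb.add h2 using 1
      simp only [C_mul, C_add]
      ring
    · rw [stepPoly, Finset.Ioc_eq_empty (by omega)]
      simpa [PolyPos.one] using PolyPos.const (L := L) le_rfl

/-- With `B = 1 - (1 + σX)A ≥ 0`, the polynomial equals `σ⁻¹ (B A + B + σ X A)`, a combination of
products of positive polynomials. -/
theorem PolyPos.sub_stepPoly_sq (hL : ∀ x y, inner ℝ (L x) y = inner ℝ x (L y))
    (hX : PolyPos L X) {η : ℕ → ℝ} (hη : ∀ j, 0 ≤ η j)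
    (h1 : ∀ j, 1 ≤ j → PolyPos L (1 - C (η j) * X)) {k n : ℕ}
    (hσ : 0 < ∑ j ∈ Finset.Ioc k n, η j) :
    PolyPos L (C (∑ j ∈ Finset.Ioc k n, η j)⁻¹
      - (X + C (∑ j ∈ Finset.Ioc k n, η j)⁻¹) * stepPoly η k n ^ 2) := by
  obtain ⟨ha, hb⟩ := PolyPos.one_sub_stepPoly hL hη h1 k n
  set σ := ∑ j ∈ Finset.Ioc k n, η j
  set A := stepPoly η k n
  have h2 := (((hb.mul hL ha).add hb).add ((hX.mul hL ha).const_mul hσ.le)).const_mul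
    (inv_nonneg.2 hσ.le)
  convert h2 using 1
  have h3 : (C σ⁻¹ : ℝ[X]) * C σ = 1 := by rw [← C_mul, inv_mul_cancel₀ hσ.ne']; simp
  linear_combination (X * A ^ 2) * h3

theorem isUnit_add_smul_one [CompleteSpace H] (hX : PolyPos L X) {lam : ℝ} (hl : 0 < lam) :
    IsUnit (L + lam • (1 : H →L[ℝ] H)) := by
  refine ContinuousLinearMap.isUnit_of_forall_le_norm_inner_map (𝕜 := ℝ) _
    (c := ⟨lam, hl.le⟩) (by exact_mod_cast hl) fun x => ?_
  have := hX x
  simp only [polyOp_X] at this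
  refine le_trans ?_ (le_abs_self _)
  simp only [add_apply, smul_apply, one_apply_eq_self, inner_add_left, inner_smul_left,
    real_inner_self_eq_norm_sq, conj_trivial]
  change ‖x‖ ^ 2 * lam ≤ _
  linarith

/-- If `(L + lam) q(L)² ≤ lam`, then `L q(L)² ≤ lam L (L + lam)⁻¹` as quadratic forms. -/
theorem inner_polyOp_le_resolvent [CompleteSpace H]
    (hL : ∀ x y, inner ℝ (L x) y = inner ℝ x (L y)) (hX : PolyPos L X) {lam : ℝ} (hl : 0 < lam)
    {q : ℝ[X]} (hq : PolyPos L (C lam - (X + C lam) * q ^ 2)) (e : H) :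
    inner ℝ (L (polyOp L q e)) (polyOp L q e)
      ≤ lam * inner ℝ ((L * Ring.inverse (L + lam • (1 : H →L[ℝ] H))) e) e := by
  obtain ⟨u, hu, hu'⟩ : ∃ u, Ring.inverse (L + lam • (1 : H →L[ℝ] H)) e = u ∧
      e = L u + lam • u := by
    refine ⟨_, rfl, ?_⟩
    have := Ring.mul_inverse_cancel _ (isUnit_add_smul_one hX hl)
    have := congrArg (fun T : H →L[ℝ] H => T e) this
    simpa using this.symm
  -- The resolvent is not a polynomial in `L`. Multiplying the hypothesis by `X (X + lam)` and
  -- testing at `u = (L + lam)⁻¹ e` turns the wanted inequality into positivity of a polynomial.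
  have h := (((hX.mul hL (hX.add (PolyPos.const hl.le))).mul hL hq)) u
  have h1 : X * (X + C lam) * (C lam - (X + C lam) * q ^ 2)
      = C lam * ((X + C lam) * X) - (X + C lam) * (q * (X * (q * (X + C lam)))) := by ring
  rw [h1] at h
  have he : polyOp L (X + C lam) u = e := by simp [hu']
  rw [polyOp_sub, inner_sub_left, polyOp_mul (X + C lam), polyOp_symm hL (X + C lam), he,
    polyOp_mul (C lam), polyOp_mul (X + C lam), polyOp_C, inner_smul_left,
    polyOp_symm hL (X + C lam), he, polyOp_mul q, polyOp_symm hL q, polyOp_mul X,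
    polyOp_mul q, he, polyOp_X, polyOp_X] at h
  simpa [hu] using h

/-- The eigenspaces of a symmetric operator are mutually orthogonal and `q(L)` acts on each as the
scalar `q(s)`. Pythagoras and Bessel bound every finite partial sum, so completeness of the
eigenvectors is not needed. -/
theorem norm_polyOp_opPow_le [CompleteSpace H]
    (hL : ∀ x y, inner ℝ (L x) y = inner ℝ x (L y)) {M : ℝ}
    (h0 : ∀ x, 0 ≤ inner ℝ (L x) x) (hM : ∀ x, inner ℝ (L x) x ≤ M * ‖x‖ ^ 2)
    {ζ c : ℝ} (hc : 0 ≤ c) {q : ℝ[X]} (hq : ∀ s, 0 ≤ s → s ≤ M → |s ^ ζ * q.eval s| ≤ c) (g : H) :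
    ‖polyOp L q (opPow L ζ g)‖ ≤ c * ‖g‖ := by
  set P : ℝ → H := fun s => (L - s • ContinuousLinearMap.id ℝ H).ker.starProjection g with hP
  have hLP : ∀ s, L (P s) = s • P s := fun s => by
    have : P s ∈ (L - s • ContinuousLinearMap.id ℝ H).ker :=
      Submodule.starProjection_apply_mem _ _
    simpa [LinearMap.mem_ker, sub_eq_zero] using this
  have horth : ∀ s t, s ≠ t → inner ℝ (P s) (P t) = 0 := fun s t hst => by
    have h := hL (P s) (P t)
    rw [hLP, hLP, inner_smul_left, inner_smul_right] at h
    have h2 : (s - t) * inner ℝ (P s) (P t) = 0 := by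
      simp only [conj_trivial] at h
      linarith
    exact (mul_eq_zero.1 h2).resolve_left (sub_ne_zero.2 hst)
  have hself : ∀ s, inner ℝ (P s) g = ‖P s‖ ^ 2 := fun s => by
    have h := Submodule.starProjection_inner_eq_zero g (P s)
      (Submodule.starProjection_apply_mem (L - s • ContinuousLinearMap.id ℝ H).ker g)
    rw [inner_sub_left, sub_eq_zero, real_inner_comm] at h
    exact h.trans (real_inner_self_eq_norm_sq _)
  have hrange : ∀ s, P s ≠ 0 → 0 ≤ s ∧ s ≤ M := fun s hs => by
    have hp : 0 < ‖P s‖ ^ 2 := by positivity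
    have ha := h0 (P s)
    have hb := hM (P s)
    rw [hLP, inner_smul_left, real_inner_self_eq_norm_sq, conj_trivial] at ha hb
    exact ⟨nonneg_of_mul_nonneg_left ha hp, le_of_mul_le_mul_right hb hp⟩
  have hpyth : ∀ (F : Finset ℝ) (a : ℝ → ℝ),
      ‖∑ s ∈ F, a s • P s‖ ^ 2 = ∑ s ∈ F, a s ^ 2 * ‖P s‖ ^ 2 := fun F a => by
    rw [← real_inner_self_eq_norm_sq, sum_inner]
    refine Finset.sum_congr rfl fun s hs => ?_
    rw [inner_sum, Finset.sum_eq_single_of_mem s hs]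
    · rw [inner_smul_left, inner_smul_right, real_inner_self_eq_norm_sq, conj_trivial]
      ring
    · intro t _ hts
      rw [inner_smul_left, inner_smul_right, horth s t hts.symm]
      simp
  have hbessel : ∀ F : Finset ℝ, ∑ s ∈ F, ‖P s‖ ^ 2 ≤ ‖g‖ ^ 2 := fun F => by
    have h1 := hpyth F fun _ => 1
    simp only [one_smul, one_pow, one_mul] at h1
    have h2 : inner ℝ (∑ s ∈ F, P s) g = ∑ s ∈ F, ‖P s‖ ^ 2 := by
      rw [sum_inner]; exact Finset.sum_congr rfl fun s _ => hself s
    have h3 := real_inner_le_norm (∑ s ∈ F, P s) g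
    rw [h2, ← h1] at h3
    rw [← h1]
    nlinarith [norm_nonneg (∑ s ∈ F, P s), norm_nonneg g]
  have hpart : ∀ F : Finset ℝ, ‖polyOp L q (∑ s ∈ F, s ^ ζ • P s)‖ ≤ c * ‖g‖ := fun F => by
    have h1 : polyOp L q (∑ s ∈ F, s ^ ζ • P s) = ∑ s ∈ F, (s ^ ζ * q.eval s) • P s := by
      rw [map_sum]
      refine Finset.sum_congr rfl fun s _ => ?_
      rw [map_smul, polyOp_eigenvector (hLP s), smul_smul]
    refine abs_le_of_sq_le_sq' ?_ (by positivity) |>.2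
    rw [h1, hpyth, mul_pow]
    refine le_trans ?_ (mul_le_mul_of_nonneg_left (hbessel F) (sq_nonneg c))
    rw [Finset.mul_sum]
    refine Finset.sum_le_sum fun s _ => ?_
    by_cases hs : P s = 0
    · simp [hs]
    · obtain ⟨ha, hb⟩ := hrange s hs
      refine mul_le_mul_of_nonneg_right ?_ (sq_nonneg _)
      exact sq_le_sq' (abs_le.1 (hq s ha hb)).1 (abs_le.1 (hq s ha hb)).2
  by_cases hsum : Summable fun s : ℝ => s ^ ζ • P s
  · have h := ((polyOp L q).continuous.tendsto _).comp hsum.hasSum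
    exact le_of_tendsto' h.norm hpart
  -- A `tsum` that does not converge has the value zero, for which the bound is trivial.
  · rw [opPow, tsum_eq_zero_of_not_summable hsum]
    simp only [map_zero, norm_zero]
    positivity

end PolynomialCalculus

/-! ### Truncated features as random vectors in `L²` -/

section FeatureMaps

/-- The truncation of `φ` to `[-κ, κ]`. -/
noncomputable def clip {V X : Type*} (κ : ℝ) (φ : V → X → ℝ) (v : V) (x : X) : ℝ := max (-κ) (min κ (φ v x))

theorem abs_clip_le {V X : Type*} {κ : ℝ} (hκ : 0 ≤ κ) (φ : V → X → ℝ) (v : V) (x : X) :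
    |clip κ φ v x| ≤ κ :=
  abs_le.2 ⟨le_max_left _ _, max_le (by linarith) (min_le_left _ _)⟩

theorem clip_eq {V X : Type*} {κ : ℝ} {φ : V → X → ℝ} {v : V} {x : X} (h : |φ v x| ≤ κ) :
    clip κ φ v x = φ v x := by
  rw [clip, min_eq_right (abs_le.1 h).2, max_eq_right (abs_le.1 h).1]

/-- By second countability every open set is a countable union of balls, and preimages of balls are
sublevel sets of distances. -/
theorem measurable_of_measurable_dist {α E : Type*} [MeasurableSpace α] [PseudoMetricSpace E]
    [SecondCountableTopology E] [MeasurableSpace E] [BorelSpace E] {f : α → E}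
    (h : ∀ g, Measurable fun a => dist (f a) g) : Measurable f := by
  refine measurable_of_isOpen fun U hU => ?_
  have hball : ∀ x : U, ∃ r > 0, Metric.ball (x : E) r ⊆ U := fun x =>
    Metric.isOpen_iff.1 hU x x.2
  choose r hr hrU using hball
  obtain ⟨S, hS, hSU⟩ := TopologicalSpace.isOpen_iUnion_countable
    (fun x : U => Metric.ball (x : E) (r x)) fun _ => Metric.isOpen_ball
  have hU' : U = ⋃ x ∈ S, Metric.ball (x : E) (r x) := by
    rw [hSU]
    refine Set.Subset.antisymm (fun x hx => ?_) (Set.iUnion_subset hrU)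
    exact Set.mem_iUnion.2 ⟨⟨x, hx⟩, Metric.mem_ball_self (hr _)⟩
  rw [hU', Set.preimage_iUnion₂]
  refine MeasurableSet.biUnion hS fun x _ => ?_
  exact measurableSet_lt (h x) measurable_const

variable {X : Type*} [MeasurableSpace X] {ν : Measure X}

theorem norm_toLp_sub_sq {f : X → ℝ} (hf : MemLp f 2 ν) (g : Lp ℝ 2 ν) :
    ‖hf.toLp f - g‖ ^ 2 = ∫ x, (f x - g x) ^ 2 ∂ν := by
  rw [← real_inner_self_eq_norm_sq, L2.inner_def]
  refine integral_congr_ae ?_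
  filter_upwards [Lp.coeFn_sub (hf.toLp f) g, hf.coeFn_toLp] with x h1 h2
  rw [h1, Pi.sub_apply, h2]
  simp [sq]

theorem inner_toLp_left {f : X → ℝ} (hf : MemLp f 2 ν) (g : Lp ℝ 2 ν) :
    inner ℝ (hf.toLp f) g = ∫ x, f x * g x ∂ν := by
  rw [L2.inner_def]
  refine integral_congr_ae ?_
  filter_upwards [hf.coeFn_toLp] with x h2
  rw [h2]
  simp [mul_comm]

theorem measurable_toLp [MeasurableSpace.CountablyGenerated X] [IsFiniteMeasure ν]
    [MeasurableSpace (Lp ℝ 2 ν)] [BorelSpace (Lp ℝ 2 ν)]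
    {W : Type*} [MeasurableSpace W] {F : W → X → ℝ} (hF : Measurable (Function.uncurry F))
    (hm : ∀ w, MemLp (F w) 2 ν) : Measurable fun w => (hm w).toLp (F w) := by
  have : Fact ((2 : ℝ≥0∞) ≠ ⊤) := ⟨by norm_num⟩
  refine measurable_of_measurable_dist fun g => ?_
  have h1 : ∀ w, dist ((hm w).toLp (F w)) g = √(∫ x, (F w x - g x) ^ 2 ∂ν) := fun w => by
    rw [← norm_toLp_sub_sq (hm w), Real.sqrt_sq (norm_nonneg _), dist_eq_norm]
  simp_rw [h1]
  refine Measurable.sqrt ?_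
  have h2 : StronglyMeasurable fun p : W × X => (F p.1 p.2 - g p.2) ^ 2 :=
    ((hF.sub ((Lp.stronglyMeasurable g).measurable.comp measurable_snd)).pow_const 2
      ).stronglyMeasurable
  exact h2.integral_prod_right'.measurable

theorem memLp_two_of_bound [IsFiniteMeasure ν] {f : X → ℝ} (hf : Measurable f) {c : ℝ}
    (hc : ∀ x, |f x| ≤ c) : MemLp f 2 ν :=
  MemLp.of_bound hf.aestronglyMeasurable c (.of_forall hc)

theorem norm_toLp_le_of_bound [IsProbabilityMeasure ν] {f : X → ℝ} (hf : Measurable f) {c : ℝ}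
    (hc0 : 0 ≤ c) (hc : ∀ x, |f x| ≤ c) :
    ‖(memLp_two_of_bound (ν := ν) hf hc).toLp f‖ ≤ c := by
  rw [Lp.norm_toLp]
  refine ENNReal.toReal_le_of_le_ofReal hc0 ?_
  refine (eLpNorm_le_of_ae_bound (C := c) (.of_forall hc)).trans ?_
  simp

variable {V : Type*} [MeasurableSpace V] {μ : Measure V}

/-- If `f > κ` on a non-null set, one such `x` satisfies `f x * f x' ≤ κ²` for almost every `x'`,
which already forces `f x' ≤ κ` almost everywhere. Applied to `f` and `-f`, this extracts `|φ_v| ≤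
κ` from the one-sided bound on products. -/
theorem ae_le_of_ae_mul_le {f : X → ℝ} {κ : ℝ} (hκ : 0 < κ)
    (h : ∀ᵐ x ∂ν, ∀ᵐ x' ∂ν, f x * f x' ≤ κ ^ 2) : ∀ᵐ x ∂ν, f x ≤ κ := by
  by_contra hcon
  have hfr : ∃ᵐ x ∂ν, κ < f x := by
    rw [Filter.Frequently]
    simpa using hcon
  obtain ⟨x, hx, hx'⟩ := (hfr.and_eventually h).exists
  refine hcon ?_
  filter_upwards [hx'] with y hy
  by_contra hlt
  push Not at hlt
  nlinarith

theorem ae_abs_le_of_ae_mul_le {f : X → ℝ} {κ : ℝ} (hκ : 0 < κ)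
    (h : ∀ᵐ x ∂ν, ∀ᵐ x' ∂ν, f x * f x' ≤ κ ^ 2) : ∀ᵐ x ∂ν, |f x| ≤ κ := by
  have h1 := ae_le_of_ae_mul_le hκ h
  have h2 := ae_le_of_ae_mul_le (f := fun x => -f x) (ν := ν) hκ (by simpa using h)
  filter_upwards [h1, h2] with x h1 h2
  exact abs_le.2 ⟨by linarith, h1⟩

theorem BoundedFeatures.ae_abs_le [SFinite μ] [SFinite ν] {φ : V → X → ℝ} {K : X → X → ℝ} {κ : ℝ}
    (hκ : 0 < κ) (h : BoundedFeatures μ ν φ K κ) : ∀ᵐ v ∂μ, ∀ᵐ x ∂ν, |φ v x| ≤ κ := by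
  filter_upwards [Measure.ae_ae_of_ae_prod h.feature_le] with v hv
  exact ae_abs_le_of_ae_mul_le hκ (Measure.ae_ae_of_ae_prod hv)

theorem measurable_clip {κ : ℝ} {φ : V → X → ℝ} (hφ : Measurable (Function.uncurry φ)) :
    Measurable (Function.uncurry (clip κ φ)) :=
  measurable_const.max (measurable_const.min hφ)

theorem BoundedFeatures.ae_clip_eq [SFinite μ] [SFinite ν] {φ : V → X → ℝ} {K : X → X → ℝ} {κ : ℝ}
    (hκ : 0 < κ) (h : BoundedFeatures μ ν φ K κ) : ∀ᵐ v ∂μ, ∀ᵐ x ∂ν, clip κ φ v x = φ v x := by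
  filter_upwards [h.ae_abs_le hκ] with v hv
  filter_upwards [hv] with x hx using clip_eq hx

/-- Truncation alters `φ` on a null set of `μ ⊗ ν`, hence by Fubini for almost every `x` only on a
null set of `v`; the integral defining `K` does not see it. -/
theorem ae_kernel_eq_clip [SFinite μ] [SFinite ν] {φ : V → X → ℝ} {K : X → X → ℝ} {κ : ℝ}
    (hκ : 0 < κ) (hφ : IsFeatureRepresentation μ ν φ K) (h : BoundedFeatures μ ν φ K κ) :
    ∀ᵐ p ∂ν.prod ν, K p.1 p.2 = ∫ v, clip κ φ v p.1 * clip κ φ v p.2 ∂μ := by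
  have hset : MeasurableSet {p : V × X | clip κ φ p.1 p.2 = φ p.1 p.2} :=
    measurableSet_eq_fun (measurable_clip hφ.measurable) hφ.measurable
  have h1 : ∀ᵐ p ∂μ.prod ν, clip κ φ p.1 p.2 = φ p.1 p.2 :=
    (Measure.ae_prod_iff_ae_ae hset).2 (h.ae_clip_eq hκ)
  have h2 : ∀ᵐ x ∂ν, ∀ᵐ v ∂μ, clip κ φ v x = φ v x :=
    (Measure.ae_prod_iff_ae_ae (μ := ν) (ν := μ)
      (p := fun p => clip κ φ p.2 p.1 = φ p.2 p.1) (measurable_swap hset)).1 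
      (Measure.prod_swap (μ := μ) (ν := ν) ▸ (ae_map_iff measurable_swap.aemeasurable
        (measurable_swap hset)).2 h1)
  have hfst : ∀ᵐ p ∂ν.prod ν, ∀ᵐ v ∂μ, clip κ φ v p.1 = φ v p.1 :=
    Measure.quasiMeasurePreserving_fst.ae h2
  have hsnd : ∀ᵐ p ∂ν.prod ν, ∀ᵐ v ∂μ, clip κ φ v p.2 = φ v p.2 :=
    Measure.quasiMeasurePreserving_snd.ae h2
  filter_upwards [hfst, hsnd] with p h1 h2
  rw [hφ.kernel_eq]
  refine integral_congr_ae ?_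
  filter_upwards [h1, h2] with v h1 h2
  rw [h1, h2]

theorem memLp_kernel_of_ae_eq [IsProbabilityMeasure μ] [IsProbabilityMeasure ν] {φ : V → X → ℝ}
    {K : X → X → ℝ} {κ : ℝ} (hφb : ∀ v x, |φ v x| ≤ κ) (hK : Measurable (Function.uncurry K))
    (hKφ : ∀ᵐ p ∂ν.prod ν, K p.1 p.2 = ∫ v, φ v p.1 * φ v p.2 ∂μ) :
    MemLp (Function.uncurry K) 2 (ν.prod ν) := by
  refine MemLp.of_bound hK.aestronglyMeasurable (κ ^ 2) ?_
  filter_upwards [hKφ] with p hp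
  rw [Function.uncurry_apply_pair (f := K) p.1 p.2, hp]
  refine (norm_integral_le_of_norm_le_const (C := κ ^ 2) (.of_forall fun v => ?_)).trans (by simp)
  rw [norm_mul, sq]
  exact mul_le_mul (hφb _ _) (hφb _ _) (norm_nonneg _) ((abs_nonneg _).trans (hφb v p.1))

variable [IsProbabilityMeasure μ] [IsProbabilityMeasure ν]

/-- The feature `φ_v` as an element of `L²(ν)`. -/
noncomputable def featLp (ν : Measure X) [IsProbabilityMeasure ν] {φ : V → X → ℝ} {κ : ℝ}
    (hφ : Measurable (Function.uncurry φ)) (hφb : ∀ v x, |φ v x| ≤ κ) (v : V) : Lp ℝ 2 ν :=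
  (memLp_two_of_bound (ν := ν) hφ.of_uncurry_left (hφb v)).toLp (φ v)

/-- Fubini: the integral operator is the average of the rank-one operators `φ_v ⊗ φ_v`. -/
theorem inner_integralOp {φ : V → X → ℝ} {K : X → X → ℝ} {κ : ℝ}
    (hφ : Measurable (Function.uncurry φ)) (hφb : ∀ v x, |φ v x| ≤ κ)
    (hK : Measurable (Function.uncurry K))
    (hKφ : ∀ᵐ p ∂ν.prod ν, K p.1 p.2 = ∫ v, φ v p.1 * φ v p.2 ∂μ) (f g : Lp ℝ 2 ν) :
    inner ℝ (integralOp K ν f) g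
      = ∫ v, inner ℝ (featLp ν hφ hφb v) f * inner ℝ (featLp ν hφ hφb v) g ∂μ := by
  have hKm := memLp_kernel_of_ae_eq (μ := μ) hφb hK hKφ
  have hfi : Integrable f ν := (Lp.memLp f).integrable one_le_two
  have hgi : Integrable g ν := (Lp.memLp g).integrable one_le_two
  have hfg : Integrable (fun p : X × X => f p.1 * g p.2) (ν.prod ν) := hfi.mul_prod hgi
  have hint : Integrable (fun q : (X × X) × V =>
      (f q.1.1 * g q.1.2) * (φ q.2 q.1.1 * φ q.2 q.1.2)) ((ν.prod ν).prod μ) := by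
    refine (hfg.comp_fst μ).mul_bdd (c := κ ^ 2) ?_ (.of_forall fun q => ?_)
    · exact ((hφ.comp (measurable_snd.prodMk measurable_fst.fst)).mul
        (hφ.comp (measurable_snd.prodMk measurable_fst.snd))).aestronglyMeasurable
    · rw [norm_mul, sq]
      exact mul_le_mul (hφb _ _) (hφb _ _) (norm_nonneg _) ((abs_nonneg _).trans (hφb q.2 q.1.1))
  have hKint : Integrable (fun p : X × X => f p.1 * K p.1 p.2 * g p.2) (ν.prod ν) := by
    refine hint.integral_prod_left.congr ?_
    filter_upwards [hKφ] with p hp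
    rw [integral_const_mul, ← hp]
    ring
  have hRHS : ∀ v, inner ℝ (featLp ν hφ hφb v) f * inner ℝ (featLp ν hφ hφb v) g
      = ∫ p, (f p.1 * g p.2) * (φ v p.1 * φ v p.2) ∂ν.prod ν := fun v => by
    rw [featLp, inner_toLp_left, inner_toLp_left, ← integral_prod_mul]
    congr 1; ext p; ring
  simp_rw [hRHS]
  rw [← integral_integral_swap (μ := ν.prod ν) (ν := μ)
    (f := fun (p : X × X) v => (f p.1 * g p.2) * (φ v p.1 * φ v p.2)) hint, L2.inner_def]
  have h1 : ∫ x', inner ℝ (integralOp K ν f x') (g x') ∂ν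
      = ∫ x', ∫ x, f x * K x x' * g x' ∂ν ∂ν := by
    refine integral_congr_ae ?_
    filter_upwards [integralOp_apply hKm f] with x' hx'
    rw [hx', integral_mul_const]
    simp [mul_comm]
  rw [h1, ← integral_prod_symm (fun p : X × X => f p.1 * K p.1 p.2 * g p.2) hKint]
  refine integral_congr_ae ?_
  filter_upwards [hKφ] with p hp
  rw [integral_const_mul, ← hp]
  ring

end FeatureMaps

/-! ### Second moments of features as traces -/

section Trace

variable {H : Type*} [NormedAddCommGroup H] [InnerProductSpace ℝ H]
  {V : Type*} [MeasurableSpace V]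

theorem integral_le_of_forall_norm_le {μ : Measure V} [IsProbabilityMeasure μ] {f : V → ℝ} {c : ℝ}
    (h : ∀ v, ‖f v‖ ≤ c) : ∫ v, f v ∂μ ≤ c := by
  have h1 := norm_integral_le_of_norm_le_const (μ := μ) (.of_forall h)
  rw [probReal_univ, mul_one] at h1
  exact (le_abs_self _).trans h1

/-- A bounded random vector `Φ` whose second moment operator is `L`. -/
structure IsFeatureMap [MeasurableSpace H] (μ : Measure V) (L : H →L[ℝ] H) (Φ : V → H)
    (κ : ℝ) : Prop where
  measurable : Measurable Φ
  norm_le : ∀ v, ‖Φ v‖ ≤ κ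
  inner_eq : ∀ f g, inner ℝ (L f) g = ∫ v, inner ℝ (Φ v) f * inner ℝ (Φ v) g ∂μ

namespace IsFeatureMap

variable [MeasurableSpace H] [BorelSpace H] [SecondCountableTopology H]
  {μ : Measure V} [IsProbabilityMeasure μ] {L : H →L[ℝ] H} {Φ : V → H} {κ : ℝ}

section

omit [BorelSpace H] [SecondCountableTopology H] [IsProbabilityMeasure μ]

theorem symm (h : IsFeatureMap μ L Φ κ) (f g : H) : inner ℝ (L f) g = inner ℝ f (L g) := by
  rw [h.inner_eq, real_inner_comm, h.inner_eq]
  simp_rw [mul_comm]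

theorem nonneg (h : IsFeatureMap μ L Φ κ) (f : H) : 0 ≤ inner ℝ (L f) f := by
  rw [h.inner_eq]
  exact integral_nonneg fun v => mul_self_nonneg _

theorem polyPos_X (h : IsFeatureMap μ L Φ κ) : PolyPos L X := fun x => by
  simpa using h.nonneg x

end

omit [BorelSpace H] [SecondCountableTopology H] in
theorem inner_le (h : IsFeatureMap μ L Φ κ) (f : H) : inner ℝ (L f) f ≤ κ ^ 2 * ‖f‖ ^ 2 := by
  rw [h.inner_eq]
  refine integral_le_of_forall_norm_le fun v => ?_
  have h1 : |inner ℝ (Φ v) f| ≤ κ * ‖f‖ := (abs_real_inner_le_norm _ _).trans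
    (mul_le_mul_of_nonneg_right (h.norm_le v) (norm_nonneg _))
  rw [norm_mul, ← mul_pow, ← sq]
  exact pow_le_pow_left₀ (norm_nonneg _) h1 2

omit [BorelSpace H] [SecondCountableTopology H] in
theorem polyPos_one_sub (h : IsFeatureMap μ L Φ κ) {c : ℝ} (hc : 0 ≤ c) (hcκ : c * κ ^ 2 ≤ 1) :
    PolyPos L (1 - C c * X) := fun x => by
  simp only [polyOp_sub, polyOp_one_apply, polyOp_mul, polyOp_C, polyOp_X, inner_sub_left,
    inner_smul_left, real_inner_self_eq_norm_sq, conj_trivial]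
  nlinarith [mul_le_mul_of_nonneg_left (h.inner_le x) hc,
    mul_le_mul_of_nonneg_right hcκ (sq_nonneg ‖x‖)]

theorem integrable_inner_mul_inner (h : IsFeatureMap μ L Φ κ) (f g : H) :
    Integrable (fun v => inner ℝ (Φ v) f * inner ℝ (Φ v) g) μ := by
  refine Integrable.of_bound (C := (κ * ‖f‖) * (κ * ‖g‖))
    ((h.measurable.inner_const.mul h.measurable.inner_const).aestronglyMeasurable)
    (.of_forall fun v => ?_)
  have h1 : ∀ f, |inner ℝ (Φ v) f| ≤ κ * ‖f‖ := fun f => (abs_real_inner_le_norm _ _).trans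
    (mul_le_mul_of_nonneg_right (h.norm_le v) (norm_nonneg _))
  rw [norm_mul]
  exact mul_le_mul (h1 f) (h1 g) (norm_nonneg _) ((abs_nonneg _).trans (h1 f))

omit [SecondCountableTopology H] in
theorem integrable_norm_sq (h : IsFeatureMap μ L Φ κ) (A : H →L[ℝ] H) :
    Integrable (fun v => ‖A (Φ v)‖ ^ 2) μ := by
  refine Integrable.of_bound (C := (‖A‖ * κ) ^ 2)
    (((A.measurable.comp h.measurable).norm.pow_const 2).aestronglyMeasurable)
    (.of_forall fun v => ?_)
  rw [norm_pow, norm_norm]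
  exact pow_le_pow_left₀ (norm_nonneg _) ((A.le_opNorm _).trans
    (mul_le_mul_of_nonneg_left (h.norm_le v) (norm_nonneg _))) 2

end IsFeatureMap

/-- Orthonormal vectors lie at mutual distance `√2`, so balls of radius `1/2` around them are
disjoint. Countability allows sum and integral to be exchanged in `lintegral_norm_sq`. -/
theorem countable_of_orthonormal [SecondCountableTopology H] {ι : Type*} {b : ι → H}
    (hb : Orthonormal ℝ b) : Countable ι := by
  refine Pairwise.countable_of_isOpen_disjoint (s := fun i => Metric.ball (b i) (1 / 2))
    (fun i j hij => ?_) (fun _ => Metric.isOpen_ball)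
    (fun i => ⟨b i, Metric.mem_ball_self (by norm_num)⟩)
  refine Metric.ball_disjoint_ball ?_
  have h1 : dist (b i) (b j) ^ 2 = 2 := by
    rw [dist_eq_norm, norm_sub_sq_real, hb.1, hb.1, hb.2 hij]
    norm_num
  nlinarith [dist_nonneg (x := b i) (y := b j)]

theorem HilbertBasis.tsum_ofReal_inner_sq {ι : Type*} (b : HilbertBasis ι ℝ H) (x : H) :
    ∑' i, ENNReal.ofReal (inner ℝ x (b i) ^ 2) = ENNReal.ofReal (‖x‖ ^ 2) := by
  have h := b.hasSum_inner_mul_inner x x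
  rw [← ENNReal.ofReal_tsum_of_nonneg (fun _ => sq_nonneg _), ← real_inner_self_eq_norm_sq,
    ← h.tsum_eq]
  · congr 1
    refine tsum_congr fun i => ?_
    rw [real_inner_comm x, sq]
  · refine h.summable.congr fun i => ?_
    rw [real_inner_comm x, sq]

variable [MeasurableSpace H] [BorelSpace H] [SecondCountableTopology H]
  {μ : Measure V} [IsProbabilityMeasure μ] {L : H →L[ℝ] H} {Φ : V → H} {κ : ℝ}

namespace IsFeatureMap

/-- Parseval inside the integral, then the second moment identity for each basis vector: the mean of
`‖A Φ‖²` is the trace of `A L A`. -/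
theorem lintegral_norm_sq (h : IsFeatureMap μ L Φ κ) {A : H →L[ℝ] H}
    (hA : ∀ x y, inner ℝ (A x) y = inner ℝ x (A y)) {ι : Type*} (b : HilbertBasis ι ℝ H) :
    ∫⁻ v, ENNReal.ofReal (‖A (Φ v)‖ ^ 2) ∂μ
      = ∑' i, ENNReal.ofReal (inner ℝ (L (A (b i))) (A (b i))) := by
  have := countable_of_orthonormal b.orthonormal
  simp_rw [← HilbertBasis.tsum_ofReal_inner_sq b]
  have hm : Measurable fun v => A (Φ v) := A.measurable.comp h.measurable
  rw [lintegral_tsum fun i => (hm.inner_const.pow_const 2).ennreal_ofReal.aemeasurable]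
  refine tsum_congr fun i => ?_
  rw [h.inner_eq, ofReal_integral_eq_lintegral_ofReal (h.integrable_inner_mul_inner _ _)
    (.of_forall fun v => mul_self_nonneg _)]
  refine lintegral_congr fun v => ?_
  rw [hA, sq]

theorem integral_norm_sq_le [CompleteSpace H] (h : IsFeatureMap μ L Φ κ) {lam : ℝ} (hl : 0 < lam) {q : ℝ[X]}
    (hq : PolyPos L (C lam - (X + C lam) * q ^ 2)) {d : ℝ} (hd : 0 ≤ d)
    (hdim : effectiveDim L lam ≤ ENNReal.ofReal d) :
    ∫ v, ‖polyOp L q (Φ v)‖ ^ 2 ∂μ ≤ lam * d := by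
  rw [← ENNReal.ofReal_le_ofReal_iff (by positivity),
    ofReal_integral_eq_lintegral_ofReal (h.integrable_norm_sq _)
      (.of_forall fun v => sq_nonneg _),
    h.lintegral_norm_sq (polyOp_symm h.symm q) (exists_hilbertBasis ℝ H).choose_spec.choose,
    ENNReal.ofReal_mul hl.le]
  refine le_trans ?_ (mul_le_mul_right hdim _)
  rw [effectiveDim, opTrace, ← ENNReal.tsum_mul_left]
  refine ENNReal.tsum_le_tsum fun i => ?_
  rw [← ENNReal.ofReal_mul hl.le]
  exact ENNReal.ofReal_le_ofReal (inner_polyOp_le_resolvent h.symm h.polyPos_X hl hq _)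

/-- The regularization level is matched to the elapsed step sizes, `lam = σ⁻¹`; then `lam * cγ *
lam^{-γ} = cγ σ^{γ-1}`. -/
theorem integral_norm_sq_stepPoly_le [CompleteSpace H] (h : IsFeatureMap μ L Φ κ) {γ cγ : ℝ} (hcγ : 0 ≤ cγ)
    (hcap : ∀ lam : ℝ, 0 < lam → effectiveDim L lam ≤ ENNReal.ofReal (cγ * lam ^ (-γ)))
    {η : ℕ → ℝ} (hη : ∀ j, 0 ≤ η j) (hηκ : ∀ j, 1 ≤ j → η j * κ ^ 2 ≤ 1) {k n : ℕ}
    (hσ : 0 < ∑ j ∈ Finset.Ioc k n, η j) :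
    ∫ v, ‖polyOp L (stepPoly η k n) (Φ v)‖ ^ 2 ∂μ
      ≤ cγ * (∑ j ∈ Finset.Ioc k n, η j) ^ (γ - 1) := by
  have h1 := h.integral_norm_sq_le (inv_pos.2 hσ) (PolyPos.sub_stepPoly_sq h.symm h.polyPos_X hη
    (fun j hj => h.polyPos_one_sub (hη j) (hηκ j hj)) hσ)
    (mul_nonneg hcγ (Real.rpow_nonneg (inv_pos.2 hσ).le _)) (hcap _ (inv_pos.2 hσ))
  refine h1.trans (le_of_eq ?_)
  rw [Real.inv_rpow hσ.le, Real.rpow_neg hσ.le, inv_inv, Real.rpow_sub_one hσ.ne']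
  field_simp

omit [BorelSpace H] [SecondCountableTopology H] in
theorem integral_norm_sq_one_le (h : IsFeatureMap μ L Φ κ) :
    ∫ v, ‖polyOp L 1 (Φ v)‖ ^ 2 ∂μ ≤ κ ^ 2 := by
  refine integral_le_of_forall_norm_le fun v => ?_
  rw [norm_pow, norm_norm, polyOp_one_apply]
  exact pow_le_pow_left₀ (norm_nonneg _) (h.norm_le v) 2

end IsFeatureMap

end Trace

/-! ### Mean and variance of one stochastic step -/

section OneStep

/-- Expanding the square, the cross term involves only the mean `c`; the two sides differ by `η²
‖c‖²`, which is dropped. -/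
theorem integral_norm_sub_smul_sq_le {E H : Type*} [NormedAddCommGroup H] [InnerProductSpace ℝ H]
    [MeasurableSpace E] {m : Measure E} [IsProbabilityMeasure m] {ξ : E → H} {a c : H}
    (h2 : Integrable (fun e => ‖ξ e‖ ^ 2) m) (h1 : Integrable (fun e => inner ℝ (ξ e) a) m)
    (hc : ∫ e, inner ℝ (ξ e) a ∂m = inner ℝ c a) (η : ℝ) :
    Integrable (fun e => ‖a - η • ξ e‖ ^ 2) m ∧
      ∫ e, ‖a - η • ξ e‖ ^ 2 ∂m ≤ ‖a - η • c‖ ^ 2 + η ^ 2 * ∫ e, ‖ξ e‖ ^ 2 ∂m := by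
  have hexp : ∀ y : H, ‖a - η • y‖ ^ 2 = ‖a‖ ^ 2 - 2 * η * inner ℝ y a + η ^ 2 * ‖y‖ ^ 2 :=
    fun y => by
      rw [norm_sub_sq_real, inner_smul_right, real_inner_comm, norm_smul, mul_pow,
        Real.norm_eq_abs, sq_abs]
      ring
  have hI : Integrable (fun e => ‖a‖ ^ 2 - 2 * η * inner ℝ (ξ e) a) m :=
    (integrable_const _).sub (h1.const_mul _)
  simp_rw [hexp]
  refine ⟨hI.add (h2.const_mul _), ?_⟩
  rw [integral_add hI (h2.const_mul _), integral_sub (integrable_const _) (h1.const_mul _),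
    integral_const, integral_const_mul, integral_const_mul, hc]
  simp only [probReal_univ, one_smul]
  nlinarith [mul_nonneg (sq_nonneg η) (sq_nonneg ‖c‖)]

variable {X : Type*} [MeasurableSpace X] {ρ : Measure (X × ℝ)}

theorem measurePreserving_fst_marginal : MeasurePreserving Prod.fst ρ ρ.fst := ⟨measurable_fst, rfl⟩

theorem memLp_snd (hy : Integrable (fun z : X × ℝ => z.2 ^ 2) ρ) :
    MemLp (fun z : X × ℝ => z.2) 2 ρ :=
  (memLp_two_iff_integrable_sq measurable_snd.aestronglyMeasurable).2 hy

theorem integral_mul_snd [IsFiniteMeasure ρ] {h : X → ℝ} (hint : Integrable (fun z : X × ℝ => h z.1 * z.2) ρ) :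
    ∫ z, h z.1 * z.2 ∂ρ = ∫ x, h x * regressionFun ρ x ∂ρ.fst := by
  rw [← Measure.integral_condKernel hint]
  refine integral_congr_ae (.of_forall fun x => ?_)
  exact integral_const_mul (h x) fun y => y

theorem integral_fst {h : X → ℝ} (hm : AEStronglyMeasurable h ρ.fst) :
    ∫ z, h z.1 ∂ρ = ∫ x, h x ∂ρ.fst := by
  rw [Measure.fst] at hm ⊢
  rw [integral_map measurable_fst.aemeasurable hm]

theorem risk_nonneg (f : X → ℝ) : 0 ≤ risk ρ f := integral_nonneg fun _ => sq_nonneg _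

variable [IsProbabilityMeasure ρ]
  {f₀ : Lp ℝ 2 ρ.fst} (hf₀ : f₀ =ᵐ[ρ.fst] regressionFun ρ)
  (hy : Integrable (fun z : X × ℝ => z.2 ^ 2) ρ)

include hf₀ hy

theorem integral_residual_sq_le {f : X → ℝ} (hf : MemLp f 2 ρ.fst) :
    Integrable (fun z : X × ℝ => (f z.1 - z.2) ^ 2) ρ ∧
    ∫ z, (f z.1 - z.2) ^ 2 ∂ρ
      ≤ 2 * ‖hf.toLp f - f₀‖ ^ 2 + 2 * risk ρ (regressionFun ρ) := by
  have hfρ : MemLp (fun z : X × ℝ => f z.1) 2 ρ := hf.comp_measurePreserving measurePreserving_fst_marginal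
  have hgρ : MemLp (fun z : X × ℝ => f₀ z.1) 2 ρ :=
    (Lp.memLp f₀).comp_measurePreserving measurePreserving_fst_marginal
  have h1 : Integrable (fun z : X × ℝ => (f z.1 - z.2) ^ 2) ρ := (hfρ.sub (memLp_snd hy)).integrable_sq
  have h2 : Integrable (fun z : X × ℝ => (f z.1 - f₀ z.1) ^ 2) ρ := (hfρ.sub hgρ).integrable_sq
  have h3 : Integrable (fun z : X × ℝ => (f₀ z.1 - z.2) ^ 2) ρ :=
    (hgρ.sub (memLp_snd hy)).integrable_sq
  refine ⟨h1, ?_⟩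
  have hrisk : risk ρ (regressionFun ρ) = ∫ z, (f₀ z.1 - z.2) ^ 2 ∂ρ := by
    refine integral_congr_ae ?_
    filter_upwards [measurePreserving_fst_marginal.quasiMeasurePreserving.ae hf₀] with z hz
    rw [hz]
  have hnorm : ‖hf.toLp f - f₀‖ ^ 2 = ∫ z, (f z.1 - f₀ z.1) ^ 2 ∂ρ := by
    rw [norm_toLp_sub_sq, ← integral_fst (h := fun x => (f x - f₀ x) ^ 2)]
    exact (hf.1.sub (Lp.aestronglyMeasurable f₀)).pow 2
  rw [hrisk, hnorm, ← integral_const_mul, ← integral_const_mul,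
    ← integral_add (h2.const_mul _) (h3.const_mul _)]
  refine integral_mono h1 ((h2.const_mul _).add (h3.const_mul _)) fun z => ?_
  nlinarith [sq_nonneg (f z.1 - f₀ z.1 - (f₀ z.1 - z.2))]

/-- Disintegration replaces `y` by its conditional mean `f_ρ(x)`. This makes the stochastic gradient
unbiased. -/
theorem integral_residual_mul {f : X → ℝ} (hf : MemLp f 2 ρ.fst) {h : X → ℝ} (hh : MemLp h 2 ρ.fst) :
    ∫ z, (f z.1 - z.2) * h z.1 ∂ρ = inner ℝ (hh.toLp h) (hf.toLp f - f₀) := by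
  have hfρ : MemLp (fun z : X × ℝ => f z.1) 2 ρ := hf.comp_measurePreserving measurePreserving_fst_marginal
  have hhρ : MemLp (fun z : X × ℝ => h z.1) 2 ρ := hh.comp_measurePreserving measurePreserving_fst_marginal
  have h1 : Integrable (fun z : X × ℝ => h z.1 * f z.1) ρ := hhρ.integrable_mul hfρ
  have h2 : Integrable (fun z : X × ℝ => h z.1 * z.2) ρ := hhρ.integrable_mul (memLp_snd hy)
  have h3 : Integrable (fun x => h x * f x) ρ.fst := hh.integrable_mul hf
  calc ∫ z, (f z.1 - z.2) * h z.1 ∂ρ = ∫ z, (h z.1 * f z.1 - h z.1 * z.2) ∂ρ := by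
        congr 1; ext z; ring
    _ = ∫ x, h x * f x ∂ρ.fst - ∫ x, h x * regressionFun ρ x ∂ρ.fst := by
        rw [integral_sub h1 h2, integral_mul_snd h2,
          integral_fst (h := fun x => h x * f x) h3.aestronglyMeasurable]
    _ = _ := by
        rw [inner_sub_right, inner_toLp_left, inner_toLp_left]
        congr 1
        · refine integral_congr_ae ?_
          filter_upwards [hf.coeFn_toLp] with x hx
          rw [hx]
        · refine integral_congr_ae ?_
          filter_upwards [hf₀] with x hx
          rw [hx]

variable {V : Type*} [MeasurableSpace V] {μ : Measure V} [IsProbabilityMeasure μ]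
  {φ : V → X → ℝ} {κ : ℝ} (hφ : Measurable (Function.uncurry φ)) (hφb : ∀ v x, |φ v x| ≤ κ)
  [MeasurableSpace (Lp ℝ 2 ρ.fst)] [BorelSpace (Lp ℝ 2 ρ.fst)]
  [SecondCountableTopology (Lp ℝ 2 ρ.fst)]
  {L : Lp ℝ 2 ρ.fst →L[ℝ] Lp ℝ 2 ρ.fst} (hΦ : IsFeatureMap μ L (featLp ρ.fst hφ hφb) κ)

include hΦ

/-- One step of the algorithm, in the seminorm `‖A ·‖` of a symmetric operator `A`. -/
theorem integral_step_le {A : Lp ℝ 2 ρ.fst →L[ℝ] Lp ℝ 2 ρ.fst}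
    (hA : ∀ x y, inner ℝ (A x) y = inner ℝ x (A y)) {f : X → ℝ} (hfm : Measurable f)
    (hf : MemLp f 2 ρ.fst) (η : ℝ) :
    Integrable (fun e : (X × ℝ) × V => ‖A (hf.toLp f - f₀
      - η • ((f e.1.1 - e.1.2) * φ e.2 e.1.1) • featLp ρ.fst hφ hφb e.2)‖ ^ 2) (ρ.prod μ) ∧
    ∫ e : (X × ℝ) × V, ‖A (hf.toLp f - f₀
      - η • ((f e.1.1 - e.1.2) * φ e.2 e.1.1) • featLp ρ.fst hφ hφb e.2)‖ ^ 2 ∂ρ.prod μ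
    ≤ ‖A ((hf.toLp f - f₀) - η • L (hf.toLp f - f₀))‖ ^ 2
      + η ^ 2 * (κ ^ 2 * (2 * ‖hf.toLp f - f₀‖ ^ 2 + 2 * risk ρ (regressionFun ρ))
        * ∫ v, ‖A (featLp ρ.fst hφ hφb v)‖ ^ 2 ∂μ) := by
  set Φ := featLp ρ.fst hφ hφb
  set u := hf.toLp f - f₀
  obtain ⟨hres, hres'⟩ := integral_residual_sq_le hf₀ hy hf
  have hΦm := hΦ.measurable
  have hφm : Measurable fun e : (X × ℝ) × V => φ e.2 e.1.1 :=
    hφ.comp (measurable_snd.prodMk measurable_fst.fst)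
  have hrm : Measurable fun e : (X × ℝ) × V => f e.1.1 - e.1.2 :=
    (hfm.comp measurable_fst.fst).sub measurable_fst.snd
  have hres1 : Integrable (fun z : X × ℝ => f z.1 - z.2) ρ :=
    ((hf.comp_measurePreserving measurePreserving_fst_marginal).sub (memLp_snd hy)).integrable one_le_two
  have hinner : ∀ g, Integrable (fun e : (X × ℝ) × V =>
      (f e.1.1 - e.1.2) * (φ e.2 e.1.1 * inner ℝ (Φ e.2) g)) (ρ.prod μ) := fun g => by
    refine (hres1.comp_fst μ).mul_bdd (c := κ * (κ * ‖g‖)) ?_ (.of_forall fun e => ?_)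
    · exact (hφm.mul (hΦm.comp measurable_snd).inner_const).aestronglyMeasurable
    · rw [norm_mul]
      exact mul_le_mul (hφb _ _) ((norm_inner_le_norm _ _).trans
        (mul_le_mul_of_nonneg_right (hΦ.norm_le _) (norm_nonneg _))) (norm_nonneg _)
        ((abs_nonneg _).trans (hφb e.2 e.1.1))
  have hmean : ∀ g, ∫ e : (X × ℝ) × V,
      (f e.1.1 - e.1.2) * (φ e.2 e.1.1 * inner ℝ (Φ e.2) g) ∂ρ.prod μ = inner ℝ (L u) g := fun g => by
    rw [integral_prod_symm _ (hinner g), hΦ.inner_eq]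
    congr 1
    ext v
    simp_rw [← mul_assoc]
    rw [integral_mul_const]
    congr 1
    exact integral_residual_mul hf₀ hy hf _
  set ξ : (X × ℝ) × V → Lp ℝ 2 ρ.fst := fun e => A (((f e.1.1 - e.1.2) * φ e.2 e.1.1) • Φ e.2)
  have hξinner : ∀ e a, inner ℝ (ξ e) a
      = (f e.1.1 - e.1.2) * (φ e.2 e.1.1 * inner ℝ (Φ e.2) (A a)) := fun e a => by
    simp only [ξ]
    rw [hA, inner_smul_left, conj_trivial, mul_assoc]
  -- The factor `φ_v(x)` couples the data point and the feature; once it is bounded by `κ`, the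
  -- second moment splits into a product of an integral over `z` and one over `v`.
  have hprod : Integrable (fun e : (X × ℝ) × V =>
      (f e.1.1 - e.1.2) ^ 2 * ‖A (Φ e.2)‖ ^ 2) (ρ.prod μ) :=
    hres.mul_prod (hΦ.integrable_norm_sq A)
  have hξle : ∀ e, ‖ξ e‖ ^ 2 ≤ κ ^ 2 * ((f e.1.1 - e.1.2) ^ 2 * ‖A (Φ e.2)‖ ^ 2) := fun e => by
    simp only [ξ]
    rw [map_smul, norm_smul, mul_pow, Real.norm_eq_abs, sq_abs, mul_pow]
    have h1 : φ e.2 e.1.1 ^ 2 ≤ κ ^ 2 := sq_le_sq' (abs_le.1 (hφb _ _)).1 (abs_le.1 (hφb _ _)).2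
    have h2 : 0 ≤ (f e.1.1 - e.1.2) ^ 2 * ‖A (Φ e.2)‖ ^ 2 := by positivity
    nlinarith [mul_le_mul_of_nonneg_right h1 h2]
  have hξint : Integrable (fun e => ‖ξ e‖ ^ 2) (ρ.prod μ) := by
    refine (hprod.const_mul (κ ^ 2)).mono' ?_ (.of_forall fun e => ?_)
    · have : ∀ e, ‖ξ e‖ ^ 2 = ((f e.1.1 - e.1.2) * φ e.2 e.1.1) ^ 2 * ‖A (Φ e.2)‖ ^ 2 := fun e => by
        simp only [ξ]
        rw [map_smul, norm_smul, mul_pow, Real.norm_eq_abs, sq_abs]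
      simp_rw [this]
      exact (((hrm.mul hφm).pow_const 2).mul
        ((A.measurable.comp (hΦm.comp measurable_snd)).norm.pow_const 2)).aestronglyMeasurable
    · rw [norm_pow, norm_norm]
      exact hξle e
  have key := integral_norm_sub_smul_sq_le (m := ρ.prod μ) (ξ := ξ) (a := A u) (c := A (L u)) hξint
    (by simp_rw [hξinner]; exact hinner _)
    (by simp_rw [hξinner]; rw [hmean, hA]) η
  have hrew : ∀ e : (X × ℝ) × V, A (u - η • ((f e.1.1 - e.1.2) * φ e.2 e.1.1) • Φ e.2)
      = A u - η • ξ e := fun e => by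
    rw [map_sub, map_smul]
  simp_rw [hrew]
  refine ⟨key.1, key.2.trans ?_⟩
  rw [show A (u - η • L u) = A u - η • A (L u) by rw [map_sub, map_smul]]
  gcongr
  refine (integral_mono hξint (hprod.const_mul _) hξle).trans ?_
  rw [integral_const_mul, integral_prod_mul (fun z : X × ℝ => (f z.1 - z.2) ^ 2)
    (fun v => ‖A (Φ v)‖ ^ 2), mul_assoc]
  gcongr

end OneStep

/-! ### The error recursion and its unrolling -/

section Recursion

/-- The iterate `f_{n+1}` as a function of the first `n` samples. -/
noncomputable def sampleIterate {X V : Type*} (φ : V → X → ℝ) (η : ℕ → ℝ) :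
    (n : ℕ) → (Fin n → (X × ℝ) × V) → X → ℝ
  | 0, _ => fun _ => 0
  | n + 1, w => fun x =>
      sampleIterate φ η n ((Fin.last n).removeNth w) x
        - η (n + 1) * (sampleIterate φ η n ((Fin.last n).removeNth w) (w (Fin.last n)).1.1
            - (w (Fin.last n)).1.2) * φ (w (Fin.last n)).2 (w (Fin.last n)).1.1
          * φ (w (Fin.last n)).2 x

theorem dslIterate_eq_sampleIterate {X V : Type*} (φ : V → X → ℝ) (η : ℕ → ℝ) (z : ℕ → X × ℝ)
    (v : ℕ → V) (n : ℕ) :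
    dslIterate φ η 0 z v (n + 1) = sampleIterate φ η n fun i => (z (i + 1), v (i + 1)) := by
  induction n with
  | zero => rfl
  | succ n ih =>
    have h1 : ((Fin.last n).removeNth fun i : Fin (n + 1) => (z (i + 1), v (i + 1)))
        = fun i : Fin n => (z (i + 1), v (i + 1)) := by
      ext i : 1
      simp [Fin.removeNth, Fin.succAbove_last]
    funext x
    rw [dslIterate, ih, sampleIterate, h1]
    simp

variable {X : Type*} [MeasurableSpace X] {V : Type*} [MeasurableSpace V]

theorem measurable_removeNth_last {E : Type*} [MeasurableSpace E] (n : ℕ) :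
    Measurable fun w : Fin (n + 1) → E => (Fin.last n).removeNth w :=
  measurable_pi_lambda _ fun _ => measurable_pi_apply _

theorem measurable_sampleIterate {φ : V → X → ℝ} (hφ : Measurable (Function.uncurry φ))
    (η : ℕ → ℝ) (n : ℕ) : Measurable (Function.uncurry (sampleIterate φ η n)) := by
  induction n with
  | zero => exact measurable_const
  | succ n ih =>
    have hr : Measurable fun p : (Fin (n + 1) → (X × ℝ) × V) × X => (Fin.last n).removeNth p.1 :=
      (measurable_removeNth_last n).comp measurable_fst
    have hw : Measurable fun p : (Fin (n + 1) → (X × ℝ) × V) × X => p.1 (Fin.last n) :=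
      (measurable_pi_apply _).comp measurable_fst
    have h1 := ih.comp (hr.prodMk measurable_snd)
    have h2 := ih.comp (hr.prodMk hw.fst.fst)
    have h3 := hφ.comp (hw.snd.prodMk hw.fst.fst)
    have h4 := hφ.comp (hw.snd.prodMk measurable_snd)
    exact h1.sub (((measurable_const.mul (h2.sub hw.fst.snd)).mul h3).mul h4)

omit [MeasurableSpace X] [MeasurableSpace V] in
theorem exists_abs_sampleIterate_le {φ : V → X → ℝ} {κ : ℝ} (hφb : ∀ v x, |φ v x| ≤ κ)
    (η : ℕ → ℝ) (n : ℕ) (w : Fin n → (X × ℝ) × V) : ∃ c, ∀ x, |sampleIterate φ η n w x| ≤ c := by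
  induction n with
  | zero => exact ⟨0, fun x => by simp [sampleIterate]⟩
  | succ n ih =>
    obtain ⟨c, hc⟩ := ih ((Fin.last n).removeNth w)
    refine ⟨c + |η (n + 1) * (sampleIterate φ η n ((Fin.last n).removeNth w)
      (w (Fin.last n)).1.1 - (w (Fin.last n)).1.2) * φ (w (Fin.last n)).2 (w (Fin.last n)).1.1| * κ,
      fun x => ?_⟩
    rw [sampleIterate]
    refine (abs_sub _ _).trans (add_le_add (hc x) ?_)
    rw [abs_mul]
    exact mul_le_mul_of_nonneg_left (hφb _ x) (abs_nonneg _)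

theorem memLp_sampleIterate {ν : Measure X} [IsFiniteMeasure ν] {φ : V → X → ℝ} {κ : ℝ}
    (hφ : Measurable (Function.uncurry φ)) (hφb : ∀ v x, |φ v x| ≤ κ) (η : ℕ → ℝ) (n : ℕ)
    (w : Fin n → (X × ℝ) × V) : MemLp (sampleIterate φ η n w) 2 ν :=
  memLp_two_of_bound (measurable_sampleIterate hφ η n).of_uncurry_left
    (exists_abs_sampleIterate_le hφb η n w).choose_spec

/-- Fubini in the last coordinate; it plays the role of conditioning on the first `n` samples. -/
theorem lintegral_pi_succ {E : Type*} [MeasurableSpace E] {m : Measure E} [IsProbabilityMeasure m]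
    {n : ℕ} {g : E → (Fin n → E) → ℝ≥0∞} (hg : Measurable (Function.uncurry g)) :
    ∫⁻ w, g (w (Fin.last n)) ((Fin.last n).removeNth w) ∂Measure.pi (fun _ : Fin (n + 1) => m)
      = ∫⁻ w, ∫⁻ e, g e w ∂m ∂Measure.pi (fun _ : Fin n => m) := by
  have h := (measurePreserving_piFinSuccAbove (fun _ : Fin (n + 1) => m)
    (Fin.last n)).lintegral_comp hg
  rw [lintegral_prod_symm' _ hg] at h
  exact h

variable {ρ : Measure (X × ℝ)} [IsProbabilityMeasure ρ] {μ : Measure V} [IsProbabilityMeasure μ]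
  {φ : V → X → ℝ} {κ : ℝ}

/-- The class in `L²` of the iterate `f_{n+1}`. -/
noncomputable def iterateLp (ρ : Measure (X × ℝ)) [IsProbabilityMeasure ρ]
    (hφ : Measurable (Function.uncurry φ)) (hφb : ∀ v x, |φ v x| ≤ κ)
    (η : ℕ → ℝ) (n : ℕ) (w : Fin n → (X × ℝ) × V) : Lp ℝ 2 ρ.fst :=
  (memLp_sampleIterate hφ hφb η n w).toLp _

variable (hφ : Measurable (Function.uncurry φ)) (hφb : ∀ v x, |φ v x| ≤ κ)

theorem iterateLp_succ (η : ℕ → ℝ) (n : ℕ) (w : Fin (n + 1) → (X × ℝ) × V) :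
    iterateLp ρ hφ hφb η (n + 1) w = iterateLp ρ hφ hφb η n ((Fin.last n).removeNth w)
      - η (n + 1) • ((sampleIterate φ η n ((Fin.last n).removeNth w) (w (Fin.last n)).1.1
            - (w (Fin.last n)).1.2) * φ (w (Fin.last n)).2 (w (Fin.last n)).1.1)
          • featLp ρ.fst hφ hφb (w (Fin.last n)).2 := by
  rw [iterateLp, iterateLp, featLp, smul_smul, ← MemLp.toLp_const_smul, ← MemLp.toLp_sub,
    MemLp.toLp_eq_toLp_iff]
  refine .of_forall fun x => ?_
  simp only [sampleIterate, Pi.sub_apply, Pi.smul_apply, smul_eq_mul]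
  ring

/-- The expectation of `‖q(L) (f_{n+1} - f₀)‖²`. -/
noncomputable def expErr (μ : Measure V) (L : Lp ℝ 2 ρ.fst →L[ℝ] Lp ℝ 2 ρ.fst)
    (f₀ : Lp ℝ 2 ρ.fst) (η : ℕ → ℝ) (n : ℕ) (q : ℝ[X]) : ℝ≥0∞ :=
  ∫⁻ w, ENNReal.ofReal (‖polyOp L q (iterateLp ρ hφ hφb η n w - f₀)‖ ^ 2)
    ∂Measure.pi fun _ : Fin n => ρ.prod μ

theorem expErr_zero {L : Lp ℝ 2 ρ.fst →L[ℝ] Lp ℝ 2 ρ.fst} (f₀ : Lp ℝ 2 ρ.fst) (η : ℕ → ℝ)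
    (q : ℝ[X]) :
    expErr hφ hφb μ L f₀ η 0 q = ENNReal.ofReal (‖polyOp L q f₀‖ ^ 2) := by
  have h0 : ∀ w, iterateLp ρ hφ hφb η 0 w = 0 := fun w => by
    rw [iterateLp]
    exact MemLp.toLp_zero _
  simp [expErr, h0]

variable {f₀ : Lp ℝ 2 ρ.fst} (hf₀ : f₀ =ᵐ[ρ.fst] regressionFun ρ)
  (hy : Integrable (fun z : X × ℝ => z.2 ^ 2) ρ)
  [MeasurableSpace.CountablyGenerated X]
  [MeasurableSpace (Lp ℝ 2 ρ.fst)] [BorelSpace (Lp ℝ 2 ρ.fst)]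
  {L : Lp ℝ 2 ρ.fst →L[ℝ] Lp ℝ 2 ρ.fst} (hΦ : IsFeatureMap μ L (featLp ρ.fst hφ hφb) κ)

theorem measurable_iterateLp (η : ℕ → ℝ) (n : ℕ) : Measurable (iterateLp ρ hφ hφb η n) :=
  measurable_toLp (measurable_sampleIterate hφ η n) _

theorem secondCountable_Lp_two {ν : Measure X} [IsFiniteMeasure ν] :
    SecondCountableTopology (Lp ℝ 2 ν) := by
  have : Fact ((2 : ℝ≥0∞) ≠ ⊤) := ⟨by norm_num⟩
  infer_instance

include hf₀ hy hΦ

/-- The mean step `1 - ηL` is absorbed into the polynomial, while the noise involves only the plain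
error `q = 1`. Working in `[0, ∞]` avoids proving integrability of the error beforehand;
`expErr_ne_top` obtains finiteness from the unrolled recursion. -/
theorem expErr_succ_le (η : ℕ → ℝ) (n : ℕ) (q : ℝ[X]) :
    expErr hφ hφb μ L f₀ η (n + 1) q
      ≤ expErr hφ hφb μ L f₀ η n (q * (1 - C (η (n + 1)) * Polynomial.X))
        + ENNReal.ofReal (η (n + 1) ^ 2 * κ ^ 2
            * ∫ v, ‖polyOp L q (featLp ρ.fst hφ hφb v)‖ ^ 2 ∂μ)
          * (2 * expErr hφ hφb μ L f₀ η n 1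
            + ENNReal.ofReal (2 * risk ρ (regressionFun ρ))) := by
  have hsc : SecondCountableTopology (Lp ℝ 2 ρ.fst) := secondCountable_Lp_two
  have hG := measurable_iterateLp (ρ := ρ) hφ hφb η n
  set Φ := featLp ρ.fst hφ hφb
  set τ := ∫ v, ‖polyOp L q (Φ v)‖ ^ 2 ∂μ
  have hτ : 0 ≤ τ := integral_nonneg fun _ => sq_nonneg _
  set S := risk ρ (regressionFun ρ)
  have hS : 0 ≤ S := risk_nonneg _
  set g : (X × ℝ) × V → (Fin n → (X × ℝ) × V) → ℝ≥0∞ := fun e w =>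
    ENNReal.ofReal (‖polyOp L q (iterateLp ρ hφ hφb η n w - f₀ - η (n + 1) •
      ((sampleIterate φ η n w e.1.1 - e.1.2) * φ e.2 e.1.1) • Φ e.2)‖ ^ 2)
  have hg : Measurable (Function.uncurry g) := by
    have h1 : Measurable fun p : ((X × ℝ) × V) × (Fin n → (X × ℝ) × V) =>
        sampleIterate φ η n p.2 p.1.1.1 :=
      (measurable_sampleIterate hφ η n).comp (measurable_snd.prodMk measurable_fst.fst.fst)
    have h2 : Measurable fun p : ((X × ℝ) × V) × (Fin n → (X × ℝ) × V) => φ p.1.2 p.1.1.1 :=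
      hφ.comp (measurable_fst.snd.prodMk measurable_fst.fst.fst)
    have h3 : Measurable fun p : ((X × ℝ) × V) × (Fin n → (X × ℝ) × V) => Φ p.1.2 :=
      hΦ.measurable.comp measurable_fst.snd
    have h4 : Measurable fun p : ((X × ℝ) × V) × (Fin n → (X × ℝ) × V) =>
        ((sampleIterate φ η n p.2 p.1.1.1 - p.1.1.2) * φ p.1.2 p.1.1.1) • Φ p.1.2 :=
      ((h1.sub measurable_fst.fst.snd).mul h2).smul h3
    have h5 : Measurable fun p : ((X × ℝ) × V) × (Fin n → (X × ℝ) × V) =>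
        iterateLp ρ hφ hφb η n p.2 - f₀ := (hG.comp measurable_snd).sub_const f₀
    exact (((polyOp L q).measurable.comp (h5.sub (h4.const_smul (η (n + 1))))).norm.pow_const
      2).ennreal_ofReal
  have hstep : ∀ w : Fin n → (X × ℝ) × V, ∫⁻ e, g e w ∂ρ.prod μ
      ≤ ENNReal.ofReal (‖polyOp L (q * (1 - C (η (n + 1)) * Polynomial.X))
          (iterateLp ρ hφ hφb η n w - f₀)‖ ^ 2)
        + ENNReal.ofReal (η (n + 1) ^ 2 * κ ^ 2 * τ)
          * (2 * ENNReal.ofReal (‖polyOp L 1 (iterateLp ρ hφ hφb η n w - f₀)‖ ^ 2)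
            + ENNReal.ofReal (2 * S)) := fun w => by
    obtain ⟨h1, h2⟩ := integral_step_le hf₀ hy hφ hφb hΦ (polyOp_symm hΦ.symm q)
      (measurable_sampleIterate hφ η n).of_uncurry_left
      (memLp_sampleIterate (ν := ρ.fst) hφ hφb η n w) (η (n + 1))
    simp only [g]
    rw [iterateLp, ← ofReal_integral_eq_lintegral_ofReal h1 (.of_forall fun _ => sq_nonneg _)]
    refine (ENNReal.ofReal_le_ofReal h2).trans (le_of_eq ?_)
    have h2' : ∀ x : ℝ, 2 * ENNReal.ofReal x = ENNReal.ofReal (2 * x) := fun x => by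
      rw [ENNReal.ofReal_mul (by norm_num), ENNReal.ofReal_ofNat]
    rw [h2', ← ENNReal.ofReal_add (by positivity) (by positivity),
      ← ENNReal.ofReal_mul (by positivity), ← ENNReal.ofReal_add (by positivity) (by positivity)]
    congr 1
    simp only [polyOp_mul, polyOp_sub, polyOp_one_apply, polyOp_C, polyOp_X]
    ring
  have hdecomp : expErr hφ hφb μ L f₀ η (n + 1) q
      = ∫⁻ w, ∫⁻ e, g e w ∂ρ.prod μ ∂Measure.pi fun _ : Fin n => ρ.prod μ := by
    rw [← lintegral_pi_succ hg, expErr]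
    refine lintegral_congr fun w => ?_
    simp only [g]
    rw [iterateLp_succ, sub_right_comm]
  rw [hdecomp]
  refine (lintegral_mono hstep).trans (le_of_eq ?_)
  have hm : ∀ q, Measurable fun w => ENNReal.ofReal
      (‖polyOp L q (iterateLp ρ hφ hφb η n w - f₀)‖ ^ 2) := fun q =>
    (((polyOp L q).measurable.comp (hG.sub_const f₀)).norm.pow_const 2).ennreal_ofReal
  rw [lintegral_add_left (hm _), lintegral_const_mul _ (((hm 1).const_mul 2).add_const _),
    lintegral_add_left ((hm 1).const_mul 2), lintegral_const_mul _ (hm 1), lintegral_const,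
    measure_univ, mul_one]
  rfl

theorem expErr_le (η : ℕ → ℝ) (n : ℕ) (q : ℝ[X]) :
    expErr hφ hφb μ L f₀ η n q
      ≤ ENNReal.ofReal (‖polyOp L (q * stepPoly η 0 n) f₀‖ ^ 2)
        + ∑ k ∈ Finset.range n, ENNReal.ofReal (η (k + 1) ^ 2 * κ ^ 2
            * ∫ v, ‖polyOp L (q * stepPoly η (k + 1) n) (featLp ρ.fst hφ hφb v)‖ ^ 2 ∂μ)
          * (2 * expErr hφ hφb μ L f₀ η k 1
            + ENNReal.ofReal (2 * risk ρ (regressionFun ρ))) := by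
  induction n generalizing q with
  | zero => simp [expErr_zero, stepPoly]
  | succ n ih =>
    refine (expErr_succ_le hφ hφb hf₀ hy hΦ η n q).trans ?_
    refine (add_le_add_left (ih _) _).trans (le_of_eq ?_)
    have hs : ∀ k ≤ n, q * (1 - C (η (n + 1)) * Polynomial.X) * stepPoly η k n = q * stepPoly η k (n + 1) :=
      fun k hk => by
        rw [stepPoly, stepPoly, Finset.prod_Ioc_succ_top hk]
        ring
    rw [Finset.sum_range_succ, hs 0 (Nat.zero_le n), ← add_assoc]
    congr 1
    · congr 1
      refine Finset.sum_congr rfl fun k hk => ?_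
      rw [hs (k + 1) (Finset.mem_range.1 hk)]
    · simp [stepPoly]

theorem expErr_ne_top (η : ℕ → ℝ) (n : ℕ) (q : ℝ[X]) : expErr hφ hφb μ L f₀ η n q ≠ ⊤ := by
  induction n using Nat.strong_induction_on generalizing q with
  | _ n ih =>
    refine ne_top_of_le_ne_top ?_ (expErr_le hφ hφb hf₀ hy hΦ η n q)
    refine ENNReal.add_ne_top.2 ⟨ENNReal.ofReal_ne_top, ?_⟩
    refine ENNReal.sum_ne_top.2 fun k hk => ENNReal.mul_ne_top ENNReal.ofReal_ne_top ?_
    exact ENNReal.add_ne_top.2 ⟨ENNReal.mul_ne_top (by norm_num)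
      (ih k (Finset.mem_range.1 hk) 1), ENNReal.ofReal_ne_top⟩

theorem toReal_expErr_le (η : ℕ → ℝ) (n : ℕ) :
    (expErr hφ hφb μ L f₀ η n 1).toReal
      ≤ ‖polyOp L (stepPoly η 0 n) f₀‖ ^ 2
        + ∑ k ∈ Finset.range n, η (k + 1) ^ 2 * κ ^ 2
            * (∫ v, ‖polyOp L (stepPoly η (k + 1) n) (featLp ρ.fst hφ hφb v)‖ ^ 2 ∂μ)
          * (2 * (expErr hφ hφb μ L f₀ η k 1).toReal + 2 * risk ρ (regressionFun ρ)) := by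
  have hS : 0 ≤ risk ρ (regressionFun ρ) := risk_nonneg _
  have hτ : ∀ q, 0 ≤ ∫ v, ‖polyOp L q (featLp ρ.fst hφ hφb v)‖ ^ 2 ∂μ := fun q =>
    integral_nonneg fun _ => sq_nonneg _
  have h := expErr_le hφ hφb hf₀ hy hΦ η n 1
  have hterm : ∀ k, ENNReal.ofReal (η (k + 1) ^ 2 * κ ^ 2
            * ∫ v, ‖polyOp L (1 * stepPoly η (k + 1) n) (featLp ρ.fst hφ hφb v)‖ ^ 2 ∂μ)
          * (2 * expErr hφ hφb μ L f₀ η k 1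
            + ENNReal.ofReal (2 * risk ρ (regressionFun ρ)))
      = ENNReal.ofReal (η (k + 1) ^ 2 * κ ^ 2
            * (∫ v, ‖polyOp L (stepPoly η (k + 1) n) (featLp ρ.fst hφ hφb v)‖ ^ 2 ∂μ)
          * (2 * (expErr hφ hφb μ L f₀ η k 1).toReal + 2 * risk ρ (regressionFun ρ))) := fun k => by
    rw [one_mul, ENNReal.ofReal_mul (mul_nonneg (by positivity) (hτ _)),
      ENNReal.ofReal_add (by positivity) (by positivity),
      ENNReal.ofReal_mul (p := 2) (q := ENNReal.toReal _) (by norm_num),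
      ENNReal.ofReal_toReal (expErr_ne_top hφ hφb hf₀ hy hΦ η k 1), ENNReal.ofReal_ofNat]
  have hnn : ∀ k ∈ Finset.range n, 0 ≤ η (k + 1) ^ 2 * κ ^ 2
            * (∫ v, ‖polyOp L (stepPoly η (k + 1) n) (featLp ρ.fst hφ hφb v)‖ ^ 2 ∂μ)
          * (2 * (expErr hφ hφb μ L f₀ η k 1).toReal + 2 * risk ρ (regressionFun ρ)) := fun k _ =>
    mul_nonneg (mul_nonneg (by positivity) (hτ _)) (by positivity)
  simp_rw [hterm] at h
  rw [one_mul, ← ENNReal.ofReal_sum_of_nonneg hnn,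
    ← ENNReal.ofReal_add (by positivity) (Finset.sum_nonneg hnn)] at h
  exact ENNReal.toReal_le_of_le_ofReal (add_nonneg (by positivity) (Finset.sum_nonneg hnn)) h

end Recursion

/-! ### Scalar estimates for polynomial step sizes -/

section StepSizes

theorem mul_rpow_le_sum_stepSize {η₁ θ : ℝ} (hη₁ : 0 ≤ η₁) (hθ : 0 ≤ θ) {k n : ℕ} (hkn : k ≤ n) :
    η₁ * ((n : ℝ) - k) * (n : ℝ) ^ (-θ)
      ≤ ∑ j ∈ Finset.Ioc k n, η₁ * (j : ℝ) ^ (-θ) := by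
  have h : ∀ j ∈ Finset.Ioc k n, η₁ * (n : ℝ) ^ (-θ) ≤ η₁ * (j : ℝ) ^ (-θ) := fun j hj => by
    obtain ⟨h1, h2⟩ := Finset.mem_Ioc.1 hj
    refine mul_le_mul_of_nonneg_left ?_ hη₁
    exact Real.rpow_le_rpow_of_nonpos (by exact_mod_cast (by omega : 0 < j))
      (by exact_mod_cast h2) (by linarith)
  have h2 := Finset.card_nsmul_le_sum _ _ _ h
  rw [Nat.card_Ioc, nsmul_eq_mul, Nat.cast_sub hkn] at h2
  linarith

/-- Raise `x / ζ ≤ exp (x / ζ)` to the power `ζ`. -/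
theorem rpow_mul_exp_neg_le {ζ x : ℝ} (hζ : 0 < ζ) (hx : 0 ≤ x) :
    x ^ ζ * Real.exp (-x) ≤ ζ ^ ζ := by
  have h1 : x ≤ ζ * Real.exp (x / ζ) := by
    have h2 : x / ζ ≤ Real.exp (x / ζ) := by linarith [Real.add_one_le_exp (x / ζ)]
    calc x = ζ * (x / ζ) := by field_simp
      _ ≤ _ := mul_le_mul_of_nonneg_left h2 hζ.le
  have h3 := Real.rpow_le_rpow hx h1 hζ.le
  rw [Real.mul_rpow hζ.le (Real.exp_pos _).le, ← Real.exp_mul, div_mul_cancel₀ _ hζ.ne'] at h3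
  calc x ^ ζ * Real.exp (-x) ≤ ζ ^ ζ * Real.exp x * Real.exp (-x) :=
        mul_le_mul_of_nonneg_right h3 (Real.exp_pos _).le
    _ = ζ ^ ζ := by rw [mul_assoc, ← Real.exp_add, add_neg_cancel, Real.exp_zero, mul_one]

theorem abs_rpow_mul_eval_stepPoly_le {ζ s σ : ℝ} (hζ : 0 < ζ) (hs : 0 ≤ s) (hσ : 0 < σ)
    {η : ℕ → ℝ} {k n : ℕ} (hη : ∀ j ∈ Finset.Ioc k n, η j * s ≤ 1)
    (hση : σ ≤ ∑ j ∈ Finset.Ioc k n, η j) :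
    |s ^ ζ * (stepPoly η k n).eval s| ≤ ζ ^ ζ * σ ^ (-ζ) := by
  have heval : (stepPoly η k n).eval s = ∏ j ∈ Finset.Ioc k n, (1 - η j * s) := by
    simp [stepPoly, eval_prod]
  have h0 : 0 ≤ ∏ j ∈ Finset.Ioc k n, (1 - η j * s) :=
    Finset.prod_nonneg fun j hj => sub_nonneg.2 (hη j hj)
  have h1 : ∏ j ∈ Finset.Ioc k n, (1 - η j * s) ≤ Real.exp (-(σ * s)) := by
    calc ∏ j ∈ Finset.Ioc k n, (1 - η j * s) ≤ ∏ j ∈ Finset.Ioc k n, Real.exp (-(η j * s)) :=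
          Finset.prod_le_prod (fun j hj => sub_nonneg.2 (hη j hj))
            fun j _ => Real.one_sub_le_exp_neg _
      _ = Real.exp (-((∑ j ∈ Finset.Ioc k n, η j) * s)) := by
          rw [← Real.exp_sum, Finset.sum_neg_distrib, Finset.sum_mul]
      _ ≤ _ := Real.exp_le_exp.2 (neg_le_neg (mul_le_mul_of_nonneg_right hση hs))
  have hs' : 0 ≤ s ^ ζ := Real.rpow_nonneg hs _
  rw [heval, abs_of_nonneg (mul_nonneg hs' h0)]
  have h2 := rpow_mul_exp_neg_le hζ (mul_nonneg hσ.le hs)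
  rw [Real.mul_rpow hσ.le hs] at h2
  have h3 : σ ^ (-ζ) * σ ^ ζ = 1 := by
    rw [← Real.rpow_add hσ, neg_add_cancel, Real.rpow_zero]
  calc s ^ ζ * ∏ j ∈ Finset.Ioc k n, (1 - η j * s) ≤ s ^ ζ * Real.exp (-(σ * s)) :=
        mul_le_mul_of_nonneg_left h1 hs'
    _ = σ ^ (-ζ) * (σ ^ ζ * s ^ ζ * Real.exp (-(σ * s))) := by
        linear_combination (-(s ^ ζ * Real.exp (-(σ * s)))) * h3
    _ ≤ σ ^ (-ζ) * ζ ^ ζ := mul_le_mul_of_nonneg_left h2 (Real.rpow_nonneg hσ.le _)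
    _ = _ := mul_comm _ _

theorem rateExp_eq (θ γ : ℝ) : rateExp θ γ = γ - 1 + θ * (1 - γ) + max (1 - 2 * θ) 0 := by
  rw [rateExp]
  rcases le_total (1 - 2 * θ) 0 with h | h
  · rw [max_eq_left (by linarith), max_eq_right h]; ring
  · rw [max_eq_right (by linarith), max_eq_left h]; ring

/-- For `θ ≤ 1/2` this is the lower bound on `θ`; for `θ ≥ 1/2` the exponent is `-(1 - γ)(1 - θ)`.
-/
theorem rateExp_neg {θ γ : ℝ} (hγ₀ : 0 ≤ γ) (hγ₁ : γ < 1) (hθ : γ / (γ + 1) < θ) (hθ₁ : θ < 1) :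
    rateExp θ γ < 0 := by
  rw [div_lt_iff₀ (by linarith)] at hθ
  rw [rateExp]
  rcases le_total (2 * θ - 1) 0 with h | h
  · rw [max_eq_right h]; linarith
  · rw [max_eq_left h]; nlinarith

/-- The weight of the `s`-th noise term at time `n`. -/
noncomputable def noiseWeight (θ γ : ℝ) (s n : ℕ) : ℝ :=
  (s : ℝ) ^ (-(2 * θ)) *
    if s < n then ((n : ℝ) - s) ^ (γ - 1) * (n : ℝ) ^ (θ * (1 - γ)) else 1

theorem noiseWeight_le {θ γ : ℝ} (hγ₀ : 0 ≤ γ) (hγ₁ : γ ≤ 1) (hθ₀ : 0 ≤ θ) (hθ₁ : θ ≤ 1)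
    {s n : ℕ} (hs : 1 ≤ s) (hsn : s ≤ n) :
    noiseWeight θ γ s n ≤ (n : ℝ) ^ rateExp θ γ *
      (4 * (1 / s) + 4 * (1 / ((n : ℝ) - s)) + if s = n then 1 else 0) := by
  have hs' : (1 : ℝ) ≤ s := by exact_mod_cast hs
  have hsn' : (s : ℝ) ≤ n := by exact_mod_cast hsn
  have hn' : (1 : ℝ) ≤ n := hs'.trans hsn'
  have hn0 : (0 : ℝ) < n := by linarith
  have hs0 : (0 : ℝ) < s := by linarith
  have ha0 : 0 ≤ (n : ℝ) ^ rateExp θ γ := Real.rpow_nonneg hn0.le _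
  have hγθ : 0 ≤ θ * (1 - γ) := mul_nonneg hθ₀ (by linarith)
  have hd : 0 ≤ 1 / ((n : ℝ) - s) := one_div_nonneg.2 (by linarith)
  rw [noiseWeight]
  rcases hsn.lt_or_eq with hlt | heq
  · have hlt' : (0 : ℝ) < n - s := by
      have : (s : ℝ) < n := by exact_mod_cast hlt
      linarith
    rw [if_pos hlt, if_neg hlt.ne, add_zero, mul_add]
    -- For `s ≤ n/2` the factor `n - s` is comparable to `n` and the sum over `s` is controlled by
    -- `1/s`; for `s > n/2` the roles are exchanged and `1/(n - s)` appears. Each comparison costs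
    -- at most `2² = 4`.
    rcases le_or_gt (2 * s) n with h2 | h2
    · have h2' : (n : ℝ) / 2 ≤ n - s := by
        have : (2 : ℝ) * s ≤ n := by exact_mod_cast h2
        linarith
      have e1 : ((n : ℝ) - s) ^ (γ - 1) ≤ 4 * (n : ℝ) ^ (γ - 1) := by
        refine (Real.rpow_le_rpow_of_nonpos (by positivity) h2' (by linarith)).trans ?_
        rw [Real.div_rpow hn0.le (by norm_num), div_eq_mul_inv, ← Real.rpow_neg (by norm_num),
          mul_comm]
        refine mul_le_mul_of_nonneg_right ?_ (Real.rpow_nonneg hn0.le _)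
        calc (2 : ℝ) ^ (-(γ - 1)) ≤ 2 ^ (2 : ℝ) :=
              Real.rpow_le_rpow_of_exponent_le (by norm_num) (by linarith)
          _ = 4 := by norm_num
      have e2 : (s : ℝ) ^ (-(2 * θ)) ≤ 1 / s * (n : ℝ) ^ max (1 - 2 * θ) 0 := by
        have : (s : ℝ) ^ (-(2 * θ)) = 1 / s * (s : ℝ) ^ (1 - 2 * θ) := by
          rw [sub_eq_add_neg, Real.rpow_add hs0, Real.rpow_one]
          field_simp
        rw [this]
        refine mul_le_mul_of_nonneg_left ?_ (by positivity)
        exact (Real.rpow_le_rpow_of_exponent_le hs' (le_max_left _ 0)).trans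
          (Real.rpow_le_rpow hs0.le hsn' (le_max_right _ _))
      have e3 : (n : ℝ) ^ rateExp θ γ = (n : ℝ) ^ max (1 - 2 * θ) 0 *
          ((n : ℝ) ^ (γ - 1) * (n : ℝ) ^ (θ * (1 - γ))) := by
        rw [← Real.rpow_add hn0, ← Real.rpow_add hn0, rateExp_eq]
        congr 1; ring
      have := mul_le_mul e2 (mul_le_mul_of_nonneg_right e1
        (Real.rpow_nonneg hn0.le (θ * (1 - γ)))) (by positivity) (by positivity)
      refine this.trans ?_
      refine le_trans (le_of_eq ?_) (le_add_of_nonneg_right (by positivity))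
      rw [e3]; ring
    · have h2' : (n : ℝ) / 2 ≤ s := by
        have : (n : ℝ) < 2 * s := by exact_mod_cast h2
        linarith
      have e1 : ((n : ℝ) - s) ^ (γ - 1) ≤ 1 / ((n : ℝ) - s) * (n : ℝ) ^ γ := by
        rw [Real.rpow_sub_one hlt'.ne', div_eq_mul_one_div, mul_comm]
        exact mul_le_mul_of_nonneg_left
          (Real.rpow_le_rpow hlt'.le (by linarith) hγ₀) hd
      have e2 : (s : ℝ) ^ (-(2 * θ)) ≤ 4 * (n : ℝ) ^ (-(2 * θ)) := by
        refine (Real.rpow_le_rpow_of_nonpos (by positivity) h2' (by linarith)).trans ?_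
        rw [Real.div_rpow hn0.le (by norm_num), div_eq_mul_inv, ← Real.rpow_neg (by norm_num),
          mul_comm]
        refine mul_le_mul_of_nonneg_right ?_ (Real.rpow_nonneg hn0.le _)
        calc (2 : ℝ) ^ (-(-(2 * θ))) ≤ 2 ^ (2 : ℝ) :=
              Real.rpow_le_rpow_of_exponent_le (by norm_num) (by linarith)
          _ = 4 := by norm_num
      have e3 : (n : ℝ) ^ (-(2 * θ)) * ((n : ℝ) ^ γ * (n : ℝ) ^ (θ * (1 - γ)))
          ≤ (n : ℝ) ^ rateExp θ γ := by
        rw [← Real.rpow_add hn0, ← Real.rpow_add hn0]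
        refine Real.rpow_le_rpow_of_exponent_le hn' ?_
        rw [rateExp]
        linarith [le_max_right (2 * θ - 1) 0]
      have := mul_le_mul e2 (mul_le_mul_of_nonneg_right e1
        (Real.rpow_nonneg hn0.le (θ * (1 - γ)))) (by positivity) (by positivity)
      refine this.trans ?_
      refine le_trans ?_ (le_add_of_nonneg_left (by positivity))
      have h5 := mul_le_mul_of_nonneg_right e3 (mul_nonneg (by norm_num : (0 : ℝ) ≤ 4) hd)
      refine le_trans (le_of_eq ?_) h5
      ring
  -- At `s = n` the term `1/(n - s)` is `1/0 = 0`, so only the indicator provides the bound.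
  · rw [if_neg (by omega), if_pos heq, mul_one, heq]
    have h1 : (n : ℝ) ^ (-(2 * θ)) ≤ (n : ℝ) ^ rateExp θ γ := by
      refine Real.rpow_le_rpow_of_exponent_le hn' ?_
      rw [rateExp]
      nlinarith [le_max_right (2 * θ - 1) 0]
    refine h1.trans (le_mul_of_one_le_right ha0 ?_)
    have : 0 ≤ 4 * (1 / (n : ℝ)) := by positivity
    simp only [sub_self, div_zero]
    linarith

theorem sum_range_inv_succ_le (n : ℕ) :
    ∑ k ∈ Finset.range n, 1 / ((k + 1 : ℕ) : ℝ) ≤ 1 + Real.log n := by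
  have h := harmonic_le_one_add_log n
  rw [harmonic] at h
  push_cast at h ⊢
  simpa using h

theorem sum_range_inv_sub_le (n : ℕ) :
    ∑ k ∈ Finset.range n, 1 / ((n : ℝ) - (k + 1 : ℕ)) ≤ 2 * (1 + Real.log n) := by
  have h1 : ∑ k ∈ Finset.range n, 1 / ((n : ℝ) - (k + 1 : ℕ))
      = ∑ k ∈ Finset.range n, 1 / ((n - 1 - k : ℕ) : ℝ) := by
    refine Finset.sum_congr rfl fun k hk => ?_
    have := Finset.mem_range.1 hk
    rw [show n - 1 - k = n - (k + 1) by omega, Nat.cast_sub (by omega)]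
  rw [h1, Finset.sum_range_reflect (fun j => 1 / ((j : ℕ) : ℝ)) n]
  refine le_trans ?_ (mul_le_mul_of_nonneg_left (sum_range_inv_succ_le n) two_pos.le)
  rw [Finset.mul_sum]
  refine Finset.sum_le_sum fun j _ => ?_
  rcases Nat.eq_zero_or_pos j with rfl | hj
  · simp
  · have hj' : (1 : ℝ) ≤ j := by exact_mod_cast hj
    push_cast
    rw [← div_eq_mul_one_div, div_le_div_iff₀ (by linarith) (by linarith)]
    linarith

theorem sum_noiseWeight_le {θ γ : ℝ} (hγ₀ : 0 ≤ γ) (hγ₁ : γ ≤ 1) (hθ₀ : 0 ≤ θ) (hθ₁ : θ ≤ 1)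
    {n : ℕ} (hn : 1 ≤ n) :
    ∑ k ∈ Finset.range n, noiseWeight θ γ (k + 1) n
      ≤ 13 * ((n : ℝ) ^ rateExp θ γ * (1 + Real.log n)) := by
  have hlog : 0 ≤ Real.log n := Real.log_natCast_nonneg n
  have h1 : ∑ k ∈ Finset.range n, (if k + 1 = n then (1 : ℝ) else 0) ≤ 1 := by
    rw [Finset.sum_eq_single_of_mem (n - 1) (Finset.mem_range.2 (by omega))]
    · split_ifs <;> norm_num
    · intro k _ hk
      rw [if_neg (by omega)]
  calc ∑ k ∈ Finset.range n, noiseWeight θ γ (k + 1) n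
      ≤ ∑ k ∈ Finset.range n, (n : ℝ) ^ rateExp θ γ * (4 * (1 / ((k + 1 : ℕ) : ℝ))
          + 4 * (1 / ((n : ℝ) - (k + 1 : ℕ))) + if k + 1 = n then 1 else 0) :=
        Finset.sum_le_sum fun k hk =>
          noiseWeight_le hγ₀ hγ₁ hθ₀ hθ₁ (by omega) (Finset.mem_range.1 hk)
    _ = (n : ℝ) ^ rateExp θ γ * (4 * ∑ k ∈ Finset.range n, 1 / ((k + 1 : ℕ) : ℝ)
          + 4 * ∑ k ∈ Finset.range n, 1 / ((n : ℝ) - (k + 1 : ℕ))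
          + ∑ k ∈ Finset.range n, if k + 1 = n then 1 else 0) := by
        rw [← Finset.mul_sum, Finset.sum_add_distrib, Finset.sum_add_distrib, ← Finset.mul_sum,
          ← Finset.mul_sum]
    _ ≤ (n : ℝ) ^ rateExp θ γ * (13 * (1 + Real.log n)) := by
        refine mul_le_mul_of_nonneg_left ?_ (Real.rpow_nonneg (Nat.cast_nonneg n) _)
        -- The constant is `13 = 4 + 4·2 + 1`.
        linarith [sum_range_inv_succ_le n, sum_range_inv_sub_le n]
    _ = _ := by ring

theorem tendsto_rpow_mul_one_add_log {a : ℝ} (ha : a < 0) :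
    Filter.Tendsto (fun n : ℕ => (n : ℝ) ^ a * (1 + Real.log n)) Filter.atTop (nhds 0) := by
  have h1 : Filter.Tendsto (fun x : ℝ => x ^ a * (1 + Real.log x)) Filter.atTop (nhds 0) := by
    have h2 : Filter.Tendsto (fun x : ℝ => x ^ a) Filter.atTop (nhds 0) := by
      simpa using tendsto_rpow_neg_atTop (neg_pos.2 ha)
    have h3 := (isLittleO_log_rpow_atTop (neg_pos.2 ha)).tendsto_div_nhds_zero
    have h4 := h2.add h3
    rw [add_zero] at h4
    refine h4.congr' ?_
    filter_upwards [Filter.eventually_gt_atTop 0] with x hx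
    rw [Real.rpow_neg hx.le]
    field_simp
  exact h1.comp tendsto_natCast_atTop_atTop

/-- A discrete Gronwall bound: if the total weights tend to zero, then the solutions of the
recursive inequality are bounded uniformly. -/
theorem exists_bound_of_recursion {W : ℕ → ℝ} (hW : Filter.Tendsto W Filter.atTop (nhds 0))
    {b S : ℝ} (hb : 0 ≤ b) (hS : 0 ≤ S) :
    ∃ M, 0 ≤ M ∧ ∀ (u : ℕ → ℝ) (w : ℕ → ℕ → ℝ), (∀ n k, 0 ≤ w n k) →
      (∀ n, ∑ k ∈ Finset.range n, w n k ≤ W n) →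
      (∀ n, u n ≤ b + ∑ k ∈ Finset.range n, w n k * (2 * u k + 2 * S)) → ∀ n, u n ≤ M := by
  obtain ⟨t, ht⟩ := Filter.eventually_atTop.1
    (hW.eventually_le_const (show (0 : ℝ) < 1 / 4 by norm_num))
  obtain ⟨Wb, hWb⟩ := hW.bddAbove_range
  have hWb' : ∀ n, W n ≤ |Wb| := fun n => (hWb ⟨n, rfl⟩).trans (le_abs_self _)
  set D := |Wb|
  have hD : 0 ≤ D := abs_nonneg _
  set c := b + 2 * D * S
  have hc : 0 ≤ c := by positivity
  have hstep : ∀ (u : ℕ → ℝ) (w : ℕ → ℕ → ℝ), (∀ n k, 0 ≤ w n k) →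
      (∀ n, ∑ k ∈ Finset.range n, w n k ≤ W n) →
      (∀ n, u n ≤ b + ∑ k ∈ Finset.range n, w n k * (2 * u k + 2 * S)) →
      ∀ n m, 0 ≤ m → (∀ k < n, u k ≤ m) → u n ≤ c + 2 * W n * m := by
    intro u w hw hws hu n m hm hk
    have h1 : ∑ k ∈ Finset.range n, w n k * (2 * u k + 2 * S) ≤ W n * (2 * m + 2 * S) := by
      refine le_trans (Finset.sum_le_sum (g := fun k => w n k * (2 * m + 2 * S)) fun k hk' => ?_) ?_
      · exact mul_le_mul_of_nonneg_left (by linarith [hk k (Finset.mem_range.1 hk')]) (hw n k)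
      · rw [← Finset.sum_mul]
        exact mul_le_mul_of_nonneg_right (hws n) (by linarith)
    have h2 := mul_le_mul_of_nonneg_right (hWb' n) hS
    have h3 := hu n
    simp only [c]
    nlinarith
  -- Crude geometric majorant for the indices up to `t`, where the weights are merely bounded by
  -- `D`. The factor `1 + 2D`, rather than `2D`, makes `r` monotone.
  set r : ℕ → ℝ := fun n => Nat.rec c (fun _ x => c + (1 + 2 * D) * x) n
  have hr : ∀ n, r (n + 1) = c + (1 + 2 * D) * r n := fun n => rfl
  have hr0 : ∀ n, 0 ≤ r n := fun n => by
    induction n with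
    | zero => exact hc
    | succ n ih => rw [hr]; positivity
  -- From index `t` on the weights total at most `1/4`, so a bound `m` on earlier terms gives `c +
  -- m/2`, which is at most `m` once `m ≥ 2c`. The bound is fixed before `u` and `w`, so it is
  -- uniform over all learning problems.
  refine ⟨max (r t) (2 * c), le_max_of_le_left (hr0 t), fun u w hw hws hu => ?_⟩
  have hst := hstep u w hw hws hu
  have hsmall : ∀ n, ∀ k ≤ n, u k ≤ r n := by
    intro n
    induction n with
    | zero =>
      intro k hk
      obtain rfl : k = 0 := by omega
      have := hst 0 0 le_rfl (by simp)
      simpa [r] using this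
    | succ n ih =>
      intro k hk
      rw [hr]
      rcases hk.lt_or_eq with h | rfl
      · nlinarith [ih k (by omega), hr0 n]
      · have := hst (n + 1) (r n) (hr0 n) fun k hk => ih k (by omega)
        nlinarith [hr0 n, mul_le_mul_of_nonneg_right (hWb' (n + 1)) (hr0 n)]
  intro n
  induction n using Nat.strong_induction_on with
  | _ n ih =>
    rcases le_or_gt n t with h | h
    · exact (hsmall t n h).trans (le_max_left _ _)
    · have h0 : 0 ≤ max (r t) (2 * c) := le_max_of_le_left (hr0 t)
      have h1 := hst n _ h0 ih
      have h2 := ht n h.le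
      nlinarith [le_max_right (r t) (2 * c), mul_le_mul_of_nonneg_right h2 h0]

end StepSizes

/-! ### From the sampled algorithm to the truncated model -/

section Reduction

variable {X : Type*} [MeasurableSpace X] {V : Type*} [MeasurableSpace V]
  {ρ : Measure (X × ℝ)} [IsProbabilityMeasure ρ] {μ : Measure V} [IsProbabilityMeasure μ]

/-- Equality for almost every `x` does not suffice to update, as the iterate is evaluated at the new
input. That input is independent of the past and has law `ρ_X`, so almost surely it avoids the
exceptional null sets. -/
theorem ae_sampleIterate_clip_eq {φ : V → X → ℝ} {K : X → X → ℝ} {κ : ℝ} (hκ : 0 < κ)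
    (hφ : Measurable (Function.uncurry φ)) (hb : BoundedFeatures μ ρ.fst φ K κ)
    (η : ℕ → ℝ) (n : ℕ) :
    ∀ᵐ w ∂Measure.pi fun _ : Fin n => ρ.prod μ, ∀ᵐ x ∂ρ.fst,
      sampleIterate (clip κ φ) η n w x = sampleIterate φ η n w x := by
  have hclip : Measurable (Function.uncurry (clip κ φ)) := measurable_clip hφ
  have hclip_ae := hb.ae_clip_eq hκ
  have hpt : MeasurePreserving (fun e : (X × ℝ) × V => e.1.1) (ρ.prod μ) ρ.fst :=
    measurePreserving_fst_marginal.comp measurePreserving_fst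
  induction n with
  | zero => exact .of_forall fun w => .of_forall fun x => rfl
  | succ n ih =>
    have h1 : ∀ᵐ p ∂(ρ.prod μ).prod (Measure.pi fun _ : Fin n => ρ.prod μ), ∀ᵐ x ∂ρ.fst,
        sampleIterate (clip κ φ) η n p.2 x = sampleIterate φ η n p.2 x :=
      Measure.quasiMeasurePreserving_snd.ae ih
    have h2 : ∀ᵐ p ∂(ρ.prod μ).prod (Measure.pi fun _ : Fin n => ρ.prod μ), ∀ᵐ x ∂ρ.fst,
        clip κ φ p.1.2 x = φ p.1.2 x :=
      (Measure.quasiMeasurePreserving_snd.comp Measure.quasiMeasurePreserving_fst).ae hclip_ae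
    have h3 : ∀ᵐ e ∂ρ.prod μ, clip κ φ e.2 e.1.1 = φ e.2 e.1.1 := by
      have hset : MeasurableSet {e : (X × ℝ) × V | clip κ φ e.2 e.1.1 = φ e.2 e.1.1} :=
        measurableSet_eq_fun (hclip.comp (measurable_snd.prodMk measurable_fst.fst))
          (hφ.comp (measurable_snd.prodMk measurable_fst.fst))
      rw [Measure.ae_prod_iff_ae_ae hset, Measure.ae_ae_comm hset]
      filter_upwards [hclip_ae] with v hv
      exact measurePreserving_fst_marginal.quasiMeasurePreserving.ae hv
    have h4 : ∀ᵐ p ∂(ρ.prod μ).prod (Measure.pi fun _ : Fin n => ρ.prod μ),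
        sampleIterate (clip κ φ) η n p.2 p.1.1.1 = sampleIterate φ η n p.2 p.1.1.1 := by
      have hset : MeasurableSet {p : ((X × ℝ) × V) × (Fin n → (X × ℝ) × V) |
          sampleIterate (clip κ φ) η n p.2 p.1.1.1 = sampleIterate φ η n p.2 p.1.1.1} :=
        measurableSet_eq_fun
          ((measurable_sampleIterate hclip η n).comp
            (measurable_snd.prodMk measurable_fst.fst.fst))
          ((measurable_sampleIterate hφ η n).comp (measurable_snd.prodMk measurable_fst.fst.fst))
      rw [Measure.ae_prod_iff_ae_ae hset, Measure.ae_ae_comm hset]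
      filter_upwards [ih] with w hw
      exact hpt.quasiMeasurePreserving.ae hw
    have h5 := h1.and (h2.and ((Measure.quasiMeasurePreserving_fst.ae h3).and h4))
    have h6 := (measurePreserving_piFinSuccAbove (fun _ : Fin (n + 1) => ρ.prod μ)
      (Fin.last n)).quasiMeasurePreserving.ae h5
    filter_upwards [h6] with w hw
    obtain ⟨h1, h2, h3, h4⟩ := hw
    change ∀ᵐ x ∂ρ.fst, sampleIterate (clip κ φ) η n ((Fin.last n).removeNth w) x
      = sampleIterate φ η n ((Fin.last n).removeNth w) x at h1
    change ∀ᵐ x ∂ρ.fst, clip κ φ (w (Fin.last n)).2 x = φ (w (Fin.last n)).2 x at h2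
    change clip κ φ (w (Fin.last n)).2 (w (Fin.last n)).1.1
      = φ (w (Fin.last n)).2 (w (Fin.last n)).1.1 at h3
    change sampleIterate (clip κ φ) η n ((Fin.last n).removeNth w) (w (Fin.last n)).1.1
      = sampleIterate φ η n ((Fin.last n).removeNth w) (w (Fin.last n)).1.1 at h4
    filter_upwards [h1, h2] with x h1 h2
    simp only [sampleIterate, h1, h2, h3, h4]

omit [IsProbabilityMeasure ρ] [IsProbabilityMeasure μ] in
theorem IsSample.map_eq_pi {Ω : Type*} [MeasurableSpace Ω] {P : Measure Ω} [IsProbabilityMeasure P]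
    {T : ℕ} {z : ℕ → Ω → X × ℝ} {v : ℕ → Ω → V} (h : IsSample P ρ μ T z v) {n : ℕ} (hn : n ≤ T) :
    AEMeasurable (fun ω (i : Fin n) => (z (i + 1) ω, v (i + 1) ω)) P ∧
    P.map (fun ω (i : Fin n) => (z (i + 1) ω, v (i + 1) ω))
      = Measure.pi fun _ : Fin n => ρ.prod μ := by
  have hmem : ∀ i : Fin n, (i : ℕ) + 1 ∈ Set.Icc 1 T := fun i => ⟨by omega, by omega⟩
  have hae : ∀ i : Fin n, AEMeasurable (fun ω => (z (i + 1) ω, v (i + 1) ω)) P := fun i =>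
    (h.hasLaw _ (hmem i)).aemeasurable
  refine ⟨aemeasurable_pi_lambda _ hae, ?_⟩
  have hinj : Function.Injective fun i : Fin n => (⟨(i : ℕ) + 1, hmem i⟩ : Set.Icc 1 T) :=
    fun i j hij => by
      simp only [Subtype.mk.injEq] at hij
      exact Fin.ext (by omega)
  have h1 := (h.indep.precomp hinj).map_fun_eq_pi_map hae
  refine h1.trans ?_
  congr 1
  ext i : 1
  exact (h.hasLaw _ (hmem i)).map_eq

theorem expectedSqError_eq_expErr {φ : V → X → ℝ} {K : X → X → ℝ} {κ : ℝ} (hκ : 0 < κ)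
    (hφ : Measurable (Function.uncurry φ)) (hb : BoundedFeatures μ ρ.fst φ K κ)
    {f₀ : Lp ℝ 2 ρ.fst} (hf₀ : f₀ =ᵐ[ρ.fst] regressionFun ρ) (η : ℕ → ℝ)
    (L : Lp ℝ 2 ρ.fst →L[ℝ] Lp ℝ 2 ρ.fst)
    {Ω : Type*} [MeasurableSpace Ω] {P : Measure Ω} [IsProbabilityMeasure P]
    {T : ℕ} {z : ℕ → Ω → X × ℝ} {v : ℕ → Ω → V} (h : IsSample P ρ μ T z v) {n : ℕ} (hn : n ≤ T) :
    expectedSqError P ρ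
        (fun ω => dslIterate φ η 0 (fun s => z s ω) (fun s => v s ω) (n + 1))
      = expErr (measurable_clip (κ := κ) hφ) (abs_clip_le hκ.le φ) μ L f₀ η n 1 := by
  obtain ⟨hae, hmap⟩ := h.map_eq_pi hn
  have hm : Measurable fun w : Fin n → (X × ℝ) × V =>
      ∫⁻ x, ENNReal.ofReal ((sampleIterate φ η n w x - f₀ x) ^ 2) ∂ρ.fst := by
    refine Measurable.lintegral_prod_right' (f := fun p : (Fin n → (X × ℝ) × V) × X =>
      ENNReal.ofReal ((sampleIterate φ η n p.1 p.2 - f₀ p.2) ^ 2)) ?_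
    exact (((measurable_sampleIterate hφ η n).sub
      ((Lp.stronglyMeasurable f₀).measurable.comp measurable_snd)).pow_const 2).ennreal_ofReal
  calc expectedSqError P ρ
        (fun ω => dslIterate φ η 0 (fun s => z s ω) (fun s => v s ω) (n + 1))
      = ∫⁻ ω, ∫⁻ x, ENNReal.ofReal ((sampleIterate φ η n
          (fun i => (z (i + 1) ω, v (i + 1) ω)) x - f₀ x) ^ 2) ∂ρ.fst ∂P := by
        refine lintegral_congr fun ω => lintegral_congr_ae ?_
        filter_upwards [hf₀] with x hx
        rw [dslIterate_eq_sampleIterate, hx]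
    _ = ∫⁻ w, ∫⁻ x, ENNReal.ofReal ((sampleIterate φ η n w x - f₀ x) ^ 2) ∂ρ.fst
          ∂Measure.pi fun _ : Fin n => ρ.prod μ := by
        rw [← hmap, lintegral_map' hm.aemeasurable hae]
    _ = _ := by
        refine lintegral_congr_ae ?_
        filter_upwards [ae_sampleIterate_clip_eq hκ hφ hb η n] with w hw
        have hF := memLp_sampleIterate (ν := ρ.fst) (measurable_clip (κ := κ) hφ)
          (abs_clip_le hκ.le φ) η n w
        rw [polyOp_one_apply, iterateLp, norm_toLp_sub_sq hF, ofReal_integral_eq_lintegral_ofReal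
          (f := fun x => (sampleIterate (clip κ φ) η n w x - f₀ x) ^ 2)
          (hF.sub (Lp.memLp f₀)).integrable_sq (.of_forall fun _ => sq_nonneg _)]
        refine lintegral_congr_ae ?_
        filter_upwards [hw] with x hx
        rw [hx]

theorem norm_eq_rhoNorm {f₀ : Lp ℝ 2 ρ.fst} (hf₀ : f₀ =ᵐ[ρ.fst] regressionFun ρ) :
    ‖f₀‖ = rhoNorm ρ (regressionFun ρ) := by
  rw [rhoNorm, ← Real.sqrt_sq (norm_nonneg f₀), ← real_inner_self_eq_norm_sq, L2.inner_def]
  congr 1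
  refine integral_congr_ae ?_
  filter_upwards [hf₀] with x hx
  rw [← hx]
  simp [sq]

theorem isFeatureMap_clip [MeasurableSpace.CountablyGenerated X]
    [MeasurableSpace (Lp ℝ 2 ρ.fst)] [BorelSpace (Lp ℝ 2 ρ.fst)]
    {φ : V → X → ℝ} {K : X → X → ℝ} {κ : ℝ} (hκ : 0 < κ)
    (hφ : IsFeatureRepresentation μ ρ.fst φ K) (hb : BoundedFeatures μ ρ.fst φ K κ) :
    IsFeatureMap μ (integralOp K ρ.fst)
      (featLp ρ.fst (measurable_clip (κ := κ) hφ.measurable) (abs_clip_le hκ.le φ)) κ where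
  measurable := measurable_toLp (measurable_clip hφ.measurable) _
  norm_le v := norm_toLp_le_of_bound (measurable_clip hφ.measurable).of_uncurry_left hκ.le
    (abs_clip_le hκ.le φ v)
  inner_eq := inner_integralOp _ _ hb.measurable_kernel (ae_kernel_eq_clip hκ hφ hb)

end Reduction

/-! ### Explicit bias and noise bounds -/

section Bounds

/-- The term `t = 1` of the maximum is `log 2 > 1/2`, so the denominator is at least `κ²`. -/
theorem stepSize_mul_le {θ γ κ cγ η₁ : ℝ} (hκ : 1 ≤ κ) (hcγ : 0 < cγ) {T : ℕ} (hT : 1 ≤ T)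
    (h : η₁ ≤ 1 / (4 * κ ^ 2 * ((2 : ℝ) ^ (2 * θ) * cγ + κ ^ 2) * cThetaGamma θ γ T)) :
    η₁ * κ ^ 2 ≤ 1 := by
  have hc : 1 / 2 ≤ cThetaGamma θ γ T := by
    have hbdd : BddAbove (Set.range fun t : Set.Icc 1 T =>
        ((t : ℕ) : ℝ) ^ rateExp θ γ * Real.log (2 * ((t : ℕ) : ℝ))) :=
      (Set.finite_range _).bddAbove
    have h1 := le_ciSup hbdd ⟨1, le_rfl, hT⟩
    refine le_trans ?_ h1
    have := Real.log_two_gt_d9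
    norm_num
    linarith
  have hκ2 : 1 ≤ κ ^ 2 := one_le_pow₀ hκ
  have h2 : 0 < (2 : ℝ) ^ (2 * θ) * cγ := by positivity
  have hden : κ ^ 2 ≤ 4 * κ ^ 2 * ((2 : ℝ) ^ (2 * θ) * cγ + κ ^ 2) * cThetaGamma θ γ T := by
    have h3 : 1 ≤ (2 : ℝ) ^ (2 * θ) * cγ + κ ^ 2 := by linarith
    have h4 : κ ^ 2 * 1 ≤ κ ^ 2 * (((2 : ℝ) ^ (2 * θ) * cγ + κ ^ 2) * (4 * cThetaGamma θ γ T)) := by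
      refine mul_le_mul_of_nonneg_left ?_ (by linarith)
      nlinarith
    linarith
  have h5 : η₁ ≤ 1 / κ ^ 2 := h.trans (one_div_le_one_div_of_le (by linarith) hden)
  calc η₁ * κ ^ 2 ≤ 1 / κ ^ 2 * κ ^ 2 := mul_le_mul_of_nonneg_right h5 (by linarith)
    _ = 1 := by field_simp

variable {H : Type*} [NormedAddCommGroup H] [InnerProductSpace ℝ H] [CompleteSpace H]
  [MeasurableSpace H] [BorelSpace H] [SecondCountableTopology H]
  {V : Type*} [MeasurableSpace V] {μ : Measure V} [IsProbabilityMeasure μ] {L : H →L[ℝ] H}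
  {Φ : V → H} {κ : ℝ}

theorem stepSize_nonneg {η₁ θ : ℝ} (hη₁ : 0 ≤ η₁) (j : ℕ) : 0 ≤ η₁ * (j : ℝ) ^ (-θ) := by
  positivity

theorem stepSize_le {η₁ θ : ℝ} (hη₁ : 0 ≤ η₁) (hθ : 0 ≤ θ) {j : ℕ} (hj : 1 ≤ j) :
    η₁ * (j : ℝ) ^ (-θ) ≤ η₁ :=
  mul_le_of_le_one_right hη₁
    (Real.rpow_le_one_of_one_le_of_nonpos (by exact_mod_cast hj) (by linarith))

/-- For `s < n` the capacity bound applies with `σ ≥ η₁ (n - s) n^{-θ}`; for `s = n` the product of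
factors is empty and only `‖Φ‖ ≤ κ` remains. The sum of both constants covers both cases. -/
theorem IsFeatureMap.noise_term_le (h : IsFeatureMap μ L Φ κ) {γ cγ θ η₁ : ℝ} (hγ₁ : γ ≤ 1)
    (hcγ : 0 ≤ cγ) (hθ : 0 ≤ θ) (hη₁ : 0 < η₁) (hηκ : η₁ * κ ^ 2 ≤ 1)
    (hcap : ∀ lam : ℝ, 0 < lam → effectiveDim L lam ≤ ENNReal.ofReal (cγ * lam ^ (-γ)))
    {s n : ℕ} (hsn : s ≤ n) :
    (η₁ * (s : ℝ) ^ (-θ)) ^ 2 * κ ^ 2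
        * ∫ v, ‖polyOp L (stepPoly (fun j => η₁ * (j : ℝ) ^ (-θ)) s n) (Φ v)‖ ^ 2 ∂μ
      ≤ η₁ ^ 2 * κ ^ 2 * (cγ * η₁ ^ (γ - 1) + κ ^ 2) * noiseWeight θ γ s n := by
  have hη0 : 0 ≤ η₁ ^ (γ - 1) := Real.rpow_nonneg hη₁.le _
  have hsq : ((s : ℝ) ^ (-θ)) ^ 2 = (s : ℝ) ^ (-(2 * θ)) := by
    rw [← Real.rpow_natCast, ← Real.rpow_mul (Nat.cast_nonneg s)]
    congr 1; push_cast; ring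
  have hs0 : 0 ≤ (s : ℝ) ^ (-(2 * θ)) := Real.rpow_nonneg (Nat.cast_nonneg s) _
  rw [mul_pow, hsq, noiseWeight]
  have key : ∫ v, ‖polyOp L (stepPoly (fun j => η₁ * (j : ℝ) ^ (-θ)) s n) (Φ v)‖ ^ 2 ∂μ
      ≤ (cγ * η₁ ^ (γ - 1) + κ ^ 2) *
        if s < n then ((n : ℝ) - s) ^ (γ - 1) * (n : ℝ) ^ (θ * (1 - γ)) else 1 := by
    rcases hsn.lt_or_eq with hlt | heq
    · have hn0 : (0 : ℝ) < n := by exact_mod_cast (by omega : 0 < n)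
      have hlt' : (0 : ℝ) < n - s := by
        have : (s : ℝ) < n := by exact_mod_cast hlt
        linarith
      have hσ := mul_rpow_le_sum_stepSize hη₁.le hθ hsn
      have hσ0 : 0 < η₁ * ((n : ℝ) - s) * (n : ℝ) ^ (-θ) := by positivity
      have h1 := h.integral_norm_sq_stepPoly_le hcγ hcap (stepSize_nonneg hη₁.le)
        (fun j hj => (mul_le_mul_of_nonneg_right (stepSize_le hη₁.le hθ hj)
          (sq_nonneg κ)).trans hηκ) (hσ0.trans_le hσ)
      refine h1.trans ?_
      have h2 : (∑ j ∈ Finset.Ioc s n, η₁ * (j : ℝ) ^ (-θ)) ^ (γ - 1)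
          ≤ η₁ ^ (γ - 1) * (((n : ℝ) - s) ^ (γ - 1) * (n : ℝ) ^ (θ * (1 - γ))) := by
        refine (Real.rpow_le_rpow_of_nonpos hσ0 hσ (by linarith)).trans (le_of_eq ?_)
        rw [Real.mul_rpow (by positivity) (by positivity), Real.mul_rpow hη₁.le hlt'.le,
          ← Real.rpow_mul hn0.le, mul_assoc, show -θ * (γ - 1) = θ * (1 - γ) by ring]
      rw [if_pos hlt, add_mul]
      refine le_trans (mul_le_mul_of_nonneg_left h2 hcγ) ?_
      rw [← mul_assoc]
      exact le_add_of_nonneg_right (by positivity)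
    · rw [if_neg (by omega), mul_one, heq]
      have h1 : stepPoly (fun j : ℕ => η₁ * (j : ℝ) ^ (-θ)) n n = 1 := by simp [stepPoly]
      rw [h1]
      exact h.integral_norm_sq_one_le.trans (le_add_of_nonneg_left (by positivity))
  have h2 := mul_le_mul_of_nonneg_left key
    (mul_nonneg (mul_nonneg (sq_nonneg η₁) hs0) (sq_nonneg κ))
  refine h2.trans (le_of_eq ?_)
  ring

omit [BorelSpace H] [SecondCountableTopology H] in
theorem IsFeatureMap.bias_le (h : IsFeatureMap μ L Φ κ) {ζ θ η₁ R : ℝ} (hζ : 0 < ζ)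
    (hθ : 0 ≤ θ) (hη₁ : 0 < η₁) (hηκ : η₁ * κ ^ 2 ≤ 1) {g : H} (hg : ‖g‖ ≤ R)
    {n : ℕ} (hn : 1 ≤ n) :
    ‖polyOp L (stepPoly (fun j => η₁ * (j : ℝ) ^ (-θ)) 0 n) (opPow L ζ g)‖ ^ 2
      ≤ (ζ ^ ζ * η₁ ^ (-ζ) * R) ^ 2 * (n : ℝ) ^ (2 * ζ * (θ - 1)) := by
  have hn0 : (0 : ℝ) < n := by exact_mod_cast hn
  have hζζ : 0 ≤ ζ ^ ζ := Real.rpow_nonneg hζ.le _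
  have hσ := mul_rpow_le_sum_stepSize (η₁ := η₁) (θ := θ) hη₁.le hθ (Nat.zero_le n)
  have hσ0 : 0 < η₁ * ((n : ℝ) - (0 : ℕ)) * (n : ℝ) ^ (-θ) := by
    rw [Nat.cast_zero, sub_zero]; positivity
  have hval : (η₁ * ((n : ℝ) - (0 : ℕ)) * (n : ℝ) ^ (-θ)) ^ (-ζ)
      = η₁ ^ (-ζ) * (n : ℝ) ^ (ζ * (θ - 1)) := by
    rw [Nat.cast_zero, sub_zero, mul_assoc, Real.mul_rpow hη₁.le (by positivity)]
    congr 1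
    rw [Real.mul_rpow hn0.le (by positivity), ← Real.rpow_mul hn0.le, ← Real.rpow_add hn0]
    congr 1; ring
  have h1 := norm_polyOp_opPow_le h.symm h.nonneg h.inner_le (ζ := ζ)
    (c := ζ ^ ζ * (η₁ * ((n : ℝ) - (0 : ℕ)) * (n : ℝ) ^ (-θ)) ^ (-ζ))
    (mul_nonneg hζζ (Real.rpow_nonneg hσ0.le _))
    (fun s hs hsκ => abs_rpow_mul_eval_stepPoly_le hζ hs hσ0
      (fun j hj => by
        have hj1 : 1 ≤ j := (Finset.mem_Ioc.1 hj).1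
        calc η₁ * (j : ℝ) ^ (-θ) * s ≤ η₁ * κ ^ 2 :=
              mul_le_mul (stepSize_le hη₁.le hθ hj1) hsκ hs hη₁.le
          _ ≤ 1 := hηκ) hσ) g
  rw [hval] at h1
  have hc : 0 ≤ ζ ^ ζ * (η₁ ^ (-ζ) * (n : ℝ) ^ (ζ * (θ - 1))) := by positivity
  have h2 := pow_le_pow_left₀ (norm_nonneg _) (h1.trans (mul_le_mul_of_nonneg_left hg hc)) 2
  refine h2.trans (le_of_eq ?_)
  have h3 : (n : ℝ) ^ (2 * ζ * (θ - 1)) = ((n : ℝ) ^ (ζ * (θ - 1))) ^ 2 := by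
    rw [← Real.rpow_natCast, ← Real.rpow_mul hn0.le]
    congr 1; push_cast; ring
  rw [h3]
  ring

end Bounds

end DoublyStochastic

/-! ### Assembly: uniform bound, then the rate -/

theorem mainTheorem5
    (ζ R κ γ cγ θ η₁ B S : ℝ) (hζ : 0 < ζ) (hR : 0 < R) (hκ : 1 ≤ κ)
    (hγ₀ : 0 ≤ γ) (hγ₁ : γ ≤ 1) (hγ : γ ≠ 1) (hcγ : 0 < cγ)
    (hθ : γ / (γ + 1) < θ) (hθ₁ : θ < 1) (hη₁ : 0 < η₁) :
    ∃ C : ℝ, 0 < C ∧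
      ∀ (d : ℕ) (X : Set (EuclideanSpace ℝ (Fin d))) (_ : IsClosed X)
        (ρ : Measure (X × ℝ)) [IsProbabilityMeasure ρ]
        (V : Type*) [MeasurableSpace V] (μ : Measure V) [IsProbabilityMeasure μ]
        (φ : V → X → ℝ) (K : X → X → ℝ),
        Integrable (fun z : X × ℝ => z.2 ^ 2) ρ →
        IsFeatureRepresentation μ ρ.fst φ K →
        BoundedFeatures μ ρ.fst φ K κ →
        SourceCondition K ρ.fst (regressionFun ρ) ζ R →
        CapacityCondition K ρ.fst γ cγ →
        rhoNorm ρ (regressionFun ρ) = B →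
        risk ρ (regressionFun ρ) = S →
        ∀ (T : ℕ), 1 ≤ T →
          η₁ ≤ 1 / (4 * κ ^ 2 * ((2 : ℝ) ^ (2 * θ) * cγ + κ ^ 2) * cThetaGamma θ γ T) →
        ∀ (Ω : Type*) [MeasurableSpace Ω] (P : Measure Ω) [IsProbabilityMeasure P]
          (z : ℕ → Ω → X × ℝ) (v : ℕ → Ω → V),
          IsSample P ρ μ T z v →
        ∀ t : ℕ, 1 ≤ t → t ≤ T →
          expectedSqError P ρ
              (fun ω => dslIterate φ (fun s => η₁ * (s : ℝ) ^ (-θ)) 0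
                (fun s => z s ω) (fun s => v s ω) (t + 1))
            ≤ ENNReal.ofReal (C * ((t : ℝ) ^ (2 * ζ * (θ - 1))
                + (t : ℝ) ^ (γ - θ * (γ + 1) + max (2 * θ - 1) 0) * Real.log t)) := by
  have hκ0 : 0 < κ := by linarith
  have hγlt : γ < 1 := lt_of_le_of_ne hγ₁ hγ
  have hθ₀ : 0 ≤ θ := (div_nonneg hγ₀ (by linarith)).trans hθ.le
  have ha := rateExp_neg hγ₀ hγlt hθ hθ₁
  set Cb : ℝ := (ζ ^ ζ * η₁ ^ (-ζ) * R) ^ 2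
  have hCb0 : 0 ≤ Cb := sq_nonneg _
  set D : ℝ := η₁ ^ 2 * κ ^ 2 * (cγ * η₁ ^ (γ - 1) + κ ^ 2) * 13 with hD
  have hC0 : 0 ≤ η₁ ^ 2 * κ ^ 2 * (cγ * η₁ ^ (γ - 1) + κ ^ 2) := by positivity
  have hD0 : 0 ≤ D := by positivity
  have hW : Filter.Tendsto (fun n : ℕ => D * ((n : ℝ) ^ rateExp θ γ * (1 + Real.log n)))
      Filter.atTop (nhds 0) := by
    simpa using (tendsto_rpow_mul_one_add_log ha).const_mul D
  -- `B ^ 2` covers the initial error at `n = 0`, where the power bound on the bias is not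
  -- available. The absolute value is taken because `S` is not yet known to be a risk.
  obtain ⟨M, hM, hbound⟩ := exists_bound_of_recursion hW
    (b := Cb + B ^ 2) (S := |S|) (by positivity) (abs_nonneg S)
  have hCpos : 0 < Cb + 3 * D * (2 * M + 2 * |S|) + 1 := by positivity
  refine ⟨Cb + 3 * D * (2 * M + 2 * |S|) + 1, hCpos, ?_⟩
  intro d X _ ρ _ V _ μ _ φ K hy hφ hb hsource hcap hB hS T hT hη Ω _ P _ z v hsample t ht htT
  have hηκ := stepSize_mul_le hκ hcγ hT hη
  obtain ⟨g, hg, hf₀⟩ := hsource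
  let : MeasurableSpace (Lp ℝ 2 ρ.fst) := borel _
  have : BorelSpace (Lp ℝ 2 ρ.fst) := ⟨rfl⟩
  have : SecondCountableTopology (Lp ℝ 2 ρ.fst) := secondCountable_Lp_two
  have hΦ := isFeatureMap_clip hκ0 hφ hb
  set η : ℕ → ℝ := fun s => η₁ * (s : ℝ) ^ (-θ)
  rw [expectedSqError_eq_expErr hκ0 hφ.measurable hb hf₀ η (integralOp K ρ.fst) hsample htT]
  set f₀ : Lp ℝ 2 ρ.fst := opPow (integralOp K ρ.fst) ζ g
  set Φ := featLp ρ.fst (measurable_clip (κ := κ) hφ.measurable) (abs_clip_le hκ0.le φ)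
  set u : ℕ → ℝ := fun n => (expErr (measurable_clip (κ := κ) hφ.measurable)
    (abs_clip_le hκ0.le φ) μ (integralOp K ρ.fst) f₀ η n 1).toReal
  set w : ℕ → ℕ → ℝ := fun n k => η (k + 1) ^ 2 * κ ^ 2
    * ∫ x, ‖polyOp (integralOp K ρ.fst) (stepPoly η (k + 1) n) (Φ x)‖ ^ 2 ∂μ
  have hw0 : ∀ n k, 0 ≤ w n k := fun n k =>
    mul_nonneg (by positivity) (integral_nonneg fun _ => sq_nonneg _)
  have hwsum : ∀ n, ∑ k ∈ Finset.range n, w n k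
      ≤ D * ((n : ℝ) ^ rateExp θ γ * (1 + Real.log n)) := fun n => by
    rcases Nat.eq_zero_or_pos n with rfl | hn
    · simp only [Finset.range_zero, Finset.sum_empty, Nat.cast_zero, Real.log_zero, add_zero,
        mul_one]
      exact mul_nonneg hD0 (Real.rpow_nonneg le_rfl _)
    · calc ∑ k ∈ Finset.range n, w n k
          ≤ ∑ k ∈ Finset.range n, η₁ ^ 2 * κ ^ 2 * (cγ * η₁ ^ (γ - 1) + κ ^ 2)
              * noiseWeight θ γ (k + 1) n := Finset.sum_le_sum fun k hk =>
            hΦ.noise_term_le hγ₁ hcγ.le hθ₀ hη₁ hηκ hcap (Finset.mem_range.1 hk)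
        _ ≤ η₁ ^ 2 * κ ^ 2 * (cγ * η₁ ^ (γ - 1) + κ ^ 2)
              * (13 * ((n : ℝ) ^ rateExp θ γ * (1 + Real.log n))) := by
            rw [← Finset.mul_sum]
            exact mul_le_mul_of_nonneg_left
              (sum_noiseWeight_le hγ₀ hγ₁ hθ₀ hθ₁.le hn) hC0
        _ = _ := by rw [hD]; ring
  have hSabs : |S| = risk ρ (regressionFun ρ) := by rw [← hS, abs_of_nonneg (risk_nonneg _)]
  have hrec : ∀ n, u n ≤ ‖polyOp (integralOp K ρ.fst) (stepPoly η 0 n) f₀‖ ^ 2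
      + ∑ k ∈ Finset.range n, w n k * (2 * u k + 2 * |S|) := fun n => by
    rw [hSabs]
    exact toReal_expErr_le _ _ hf₀ hy hΦ η n
  have hbias : ∀ n : ℕ, 1 ≤ n → ‖polyOp (integralOp K ρ.fst) (stepPoly η 0 n) f₀‖ ^ 2
      ≤ Cb * (n : ℝ) ^ (2 * ζ * (θ - 1)) := fun n hn =>
    hΦ.bias_le hζ hθ₀ hη₁ hηκ hg hn
  have hbias' : ∀ n, ‖polyOp (integralOp K ρ.fst) (stepPoly η 0 n) f₀‖ ^ 2 ≤ Cb + B ^ 2 :=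
    fun n => by
      rcases Nat.eq_zero_or_pos n with rfl | hn
      · simp only [stepPoly, Finset.Ioc_self, Finset.prod_empty, polyOp_one_apply]
        rw [norm_eq_rhoNorm hf₀, hB]
        linarith
      · refine (hbias n hn).trans ((mul_le_of_le_one_right hCb0 ?_).trans
          (le_add_of_nonneg_right (sq_nonneg B)))
        exact Real.rpow_le_one_of_one_le_of_nonpos (by exact_mod_cast hn)
          (mul_nonpos_of_nonneg_of_nonpos (by linarith) (by linarith))
  -- The recursion is used twice: here for a uniform bound, and in `hfin` with that bound inserted
  -- to obtain the decay.
  have huM := hbound u w hw0 hwsum fun n => (hrec n).trans (by linarith [hbias' n])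
  have hfin : u t ≤ Cb * (t : ℝ) ^ (2 * ζ * (θ - 1))
      + D * ((t : ℝ) ^ rateExp θ γ * (1 + Real.log t)) * (2 * M + 2 * |S|) := by
    refine (hrec t).trans (add_le_add (hbias t ht) ?_)
    refine (Finset.sum_le_sum (g := fun k => w t k * (2 * M + 2 * |S|)) fun k _ =>
      mul_le_mul_of_nonneg_left (by linarith [huM k]) (hw0 t k)).trans ?_
    rw [← Finset.sum_mul]
    exact mul_le_mul_of_nonneg_right (hwsum t) (by positivity)
  rw [← ENNReal.ofReal_toReal (expErr_ne_top _ _ hf₀ hy hΦ η t 1)]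
  refine ENNReal.ofReal_le_ofReal (hfin.trans ?_)
  change _ ≤ (Cb + 3 * D * (2 * M + 2 * |S|) + 1)
    * ((t : ℝ) ^ (2 * ζ * (θ - 1)) + (t : ℝ) ^ rateExp θ γ * Real.log t)
  have hDM : 0 ≤ D * (2 * M + 2 * |S|) := by positivity
  have hp : 0 ≤ (t : ℝ) ^ (2 * ζ * (θ - 1)) := Real.rpow_nonneg (Nat.cast_nonneg t) _
  have hq : 0 ≤ (t : ℝ) ^ rateExp θ γ := Real.rpow_nonneg (Nat.cast_nonneg t) _
  have hl : 0 ≤ Real.log t := Real.log_natCast_nonneg t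
  -- The target has `log t` in place of `1 + log t`. At `t = 1` the logarithm vanishes and the bias
  -- term `1` compensates; for `t ≥ 2`, `log t > 1/2` gives `1 + log t ≤ 3 log t`.
  have hkey : (t : ℝ) ^ rateExp θ γ * (1 + Real.log t)
      ≤ 3 * ((t : ℝ) ^ (2 * ζ * (θ - 1)) + (t : ℝ) ^ rateExp θ γ * Real.log t) := by
    rcases ht.eq_or_lt with rfl | ht2
    · simp
    · have h2 : Real.log 2 ≤ Real.log t :=
        Real.log_le_log (by norm_num) (by exact_mod_cast ht2)
      have h3 := Real.log_two_gt_d9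
      have h4 := mul_le_mul_of_nonneg_left (show 1 + Real.log t ≤ 3 * Real.log t by linarith) hq
      linarith
  have h1 := mul_le_mul_of_nonneg_left hkey hDM
  have h2 : 0 ≤ (t : ℝ) ^ rateExp θ γ * Real.log t := mul_nonneg hq hl
  nlinarith [mul_nonneg hCb0 h2]
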